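/- **Theorem 5.1 (Balanced 2-cut Induction Tool).** All graphs are finite and loopless; parallel edges are allowed. A connected graph with at least four vertices is *matching covered* if each of its edges lies in a perfect matching; a matching covered graph is *minimal* if deleting any one edge yields a graph that is not matching covered. Let $\mathcal H_2$ be the class of *extremal* minimal bipartite matching covered graphs, that is, minimal bipartite matching covered graphs with $|V_2| = 2(m-n+2)$, where $n$ and $m$ are the numbers of vertices and edges and $V_2$ is the set of vertices of degree two. Let $G$ be a bipartite graph with colour classes $A$ and $B$, and let $X\subseteq V(G)$ be such that the set $F=\partial(X)$ of edges joining $X$ to $\overline X = V(G)\setminus X$ is a balanced $2$-cut: $|F|=2$, exactly one edge of $F$ has its end in $X$ in $A$, and exactly one has its end in $X$ in $B$. Let $a_1\in A$ and $b_1\in B$ be the ends of the edges of $F$ in $X$, and let $a_2\in A$ and $b_2\in B$ be their ends in $\overline X$ (so $F=\{a_1b_2,\,a_2b_1\}$). Let $G_1$ be obtained from the induced subgraph $G[X]$ by adding two new vertices $v_1,u_1$ and the three edges of the path $a_1v_1u_1b_1$, and let $G_2$ be obtained from $G[\overline X]$ by adding two new vertices $v_2,u_2$ and the three edges of the path $a_2v_2u_2b_2$.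 Then $G_1$ and $G_2$ are bipartite, and: 1. $G$ is matching covered if and only if $G_1$ and $G_2$ are both matching covered; 2. $G$ is a minimal matching covered graph if and only if $G_1$ and $G_2$ are both minimal matching covered graphs; 3. $G\in\mathcal H_2$ if and only if $G_1\in\mathcal H_2$ and $G_2\in\mathcal H_2$. -/

import Mathlib

open scoped Graph

namespace Graph

variable {α β : Type*}

/-! All graphs of interest below are bipartite multigraphs (parallel edges allowed), hence
loopless; matchings and degrees are defined accordingly. -/

/-- A graph is connected if it is nonempty and any two vertices are joined by a walk. -/
def IsConnected (G : Graph α β) : Prop :=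
  V(G).Nonempty ∧ ∀ x ∈ V(G), ∀ y ∈ V(G), Relation.ReflTransGen G.Adj x y

/-- `G[A, B]`: a bipartite graph with colour classes `A` and `B`. -/
structure IsBipartition (G : Graph α β) (A B : Set α) : Prop where
  disjoint : Disjoint A B
  union_eq : A ∪ B = V(G)
  of_isLink : ∀ ⦃e x y⦄, G.IsLink e x y → (x ∈ A ∧ y ∈ B) ∨ (x ∈ B ∧ y ∈ A)

/-- A graph is bipartite if it has a pair of colour classes. -/
def IsBipartite (G : Graph α β) : Prop := ∃ A B, G.IsBipartition A B

/-- A set of edges meeting every vertex exactly once (in a loopless graph). -/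
structure IsPerfectMatching (G : Graph α β) (M : Set β) : Prop where
  subset : M ⊆ E(G)
  existsUnique : ∀ x ∈ V(G), ∃! e, e ∈ M ∧ G.Inc e x

/-- Matching covered: connected, of order at least four, every edge in a perfect matching. -/
structure IsMatchingCovered (G : Graph α β) : Prop where
  connected : G.IsConnected
  four_le_order : 4 ≤ V(G).ncard
  matchable : ∀ e ∈ E(G), ∃ M, G.IsPerfectMatching M ∧ e ∈ M

/-- Minimal matching covered: deleting any one edge destroys the matching covered property. -/
structure IsMinimalMatchingCovered (G : Graph α β) : Prop where
  matchingCovered : G.IsMatchingCovered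
  minimal : ∀ e ∈ E(G), ¬ (G.deleteEdges {e}).IsMatchingCovered

/-- The set of vertices of degree two (in a loopless graph). -/
def degreeTwoSet (G : Graph α β) : Set α := {x ∈ V(G) | (G.incidenceSet x).ncard = 2}

/-- The class `H₂`: minimal bipartite matching covered graphs with `|V₂| = 2 (m - n + 2)`. -/
structure IsExtremal (G : Graph α β) : Prop where
  bipartite : G.IsBipartite
  minimal : G.IsMinimalMatchingCovered
  card_degreeTwoSet :
    (G.degreeTwoSet.ncard : ℤ) = 2 * ((E(G).ncard : ℤ) - (V(G).ncard : ℤ) + 2)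

/-- The cut `∂(X)`. -/
def cut (G : Graph α β) (X : Set α) : Set β :=
  {e | ∃ x y, G.IsLink e x y ∧ x ∈ X ∧ y ∉ X}

/-- The edges of `∂(X)` whose end in `X` belongs to `C`. -/
def cutFrom (G : Graph α β) (C X : Set α) : Set β :=
  {e | ∃ x y, G.IsLink e x y ∧ x ∈ X ∧ y ∉ X ∧ x ∈ C}

/-- `∂(X)` is a balanced 2-cut of `G[A, B]`. -/
structure IsBalancedTwoCut (G : Graph α β) (A B X : Set α) : Prop where
  subset : X ⊆ V(G)
  card_cut : (G.cut X).ncard = 2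
  balanced : (G.cutFrom A X).ncard = (G.cutFrom B X).ncard

/-- The three edges of the path `a v u b`, where `v` and `u` are the new vertices
`Sum.inr 0` and `Sum.inr 1`. -/
def earEnds (a b : α) : Fin 3 → Sym2 (α ⊕ Fin 2) :=
  ![s(.inl a, .inr 0), s(.inr 0, .inr 1), s(.inr 1, .inl b)]

/-- The union of `H` and the path `a v u b` of length three, where `v` and `u` are new vertices
and the three edges of the path are new edges. For `a, b ∈ V(H)`, distinct, this adds to `H` an ear
of length three with ends `a` and `b`. -/
def addEar (H : Graph α β) (a b : α) : Graph (α ⊕ Fin 2) (β ⊕ Fin 3) where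
  vertexSet := Sum.inl '' (V(H) ∪ {a, b}) ∪ Set.range Sum.inr
  edgeSet := Sum.inl '' E(H) ∪ Set.range Sum.inr
  IsLink e x y := match e with
    | .inl e => ∃ x' y', H.IsLink e x' y' ∧ x = .inl x' ∧ y = .inl y'
    | .inr i => s(x, y) = earEnds a b i
  isLink_symm := by
    rintro (e | i) -
    · exact ⟨by rintro _ _ ⟨x, y, h, rfl, rfl⟩; exact ⟨y, x, h.symm, rfl, rfl⟩⟩
    · exact ⟨by intro x y h; rw [Sym2.eq_swap]; exact h⟩
  eq_or_eq_of_isLink_of_isLink := by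
    rintro (e | i) x y v w h h'
    · obtain ⟨x, y, h, rfl, rfl⟩ := h
      obtain ⟨v, w, h', rfl, rfl⟩ := h'
      simpa using H.eq_or_eq_of_isLink_of_isLink h h'
    · have h1 : s(x, y) = s(v, w) := Eq.trans h (Eq.symm h')
      rcases Sym2.eq_iff.1 h1 with h | h
      · exact .inl h.1
      · exact .inr h.1
  edge_mem_iff_exists_isLink := by
    rintro (e | i)
    · simp only [Set.mem_union, Set.mem_image, Sum.inl.injEq, exists_eq_right, Set.mem_range,
        reduceCtorEq, exists_false, or_false]
      constructor
      · intro h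
        obtain ⟨x, y, h⟩ := H.exists_isLink_of_mem_edgeSet h
        exact ⟨_, _, x, y, h, rfl, rfl⟩
      · rintro ⟨_, _, x, y, h, -, -⟩
        exact h.edge_mem
    · refine ⟨fun _ ↦ ?_, fun _ ↦ .inr ⟨i, rfl⟩⟩
      induction h : earEnds a b i with
      | h x y => exact ⟨x, y, h.symm⟩
  left_mem_of_isLink := by
    rintro (e | i) x y h
    · obtain ⟨x, y, h, rfl, rfl⟩ := h
      exact .inl ⟨x, .inl h.left_mem, rfl⟩
    · have hx : x ∈ earEnds a b i := by
        rw [← show s(x, y) = earEnds a b i from h]; exact Sym2.mem_mk_left x y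
      fin_cases i <;> simp [earEnds] at hx <;> rcases hx with rfl | rfl <;> simp

/-- `G₁` and `G₂` are obtained from `G[A, B]` by a 2-cut decomposition across the balanced 2-cut
`∂(X)`: here `a₁ ∈ A` and `b₁ ∈ B` are the ends in `X` of the cut edges, `a₂ ∈ A` and `b₂ ∈ B`
are their ends outside `X`, and `Gᵢ` is the subgraph induced on the `i`-th side of the cut
together with a new ear of length three joining `aᵢ` and `bᵢ`. -/
def IsTwoCutDecomposition (G : Graph α β) (A B X : Set α)
    (G₁ G₂ : Graph (α ⊕ Fin 2) (β ⊕ Fin 3)) : Prop :=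
  G.IsBalancedTwoCut A B X ∧
  ∃ a₁ ∈ A ∩ X, ∃ b₁ ∈ B ∩ X, ∃ a₂ ∈ A \ X, ∃ b₂ ∈ B \ X,
    (∃ e ∈ G.cut X, G.Inc e a₁) ∧ (∃ e ∈ G.cut X, G.Inc e b₁) ∧
    (∃ e ∈ G.cut X, G.Inc e a₂) ∧ (∃ e ∈ G.cut X, G.Inc e b₂) ∧
    G₁ = (G.induce X).addEar a₁ b₁ ∧ G₂ = (G.induce (V(G) \ X)).addEar a₂ b₂

end Graph

/-! By Hall's theorem, a bipartite graph with classes `A` and `B` is matching covered exactly when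
`#A = #B ≥ 2` and every nonempty proper `T ⊆ A` has at least `#T + 1` neighbours
(`isMatchingCovered_iff_expanding`). Everything becomes a count of neighbourhoods.

Matching covered: split a set `T ⊆ A` along the cut. The far side influences the near one only
through whether `b₁` is gained (when `a₂ ∈ T`), and the near side gives away `b₂` only when `a₁ ∈
T`. An ear of length three records the same two bits, so gluing and ear addition both reduce to
`EarExpanding` (`expanding_iff_earExpanding`, `isMatchingCovered_addEar_iff`).

Minimality: deleting an edge inside one side commutes with the decomposition, so the first
equivalence applies to the graph without that edge. The cut edges of `G` and the ear edges of the
two pieces can never be deleted.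

Extremality: passing from `G` to the two pieces raises each of `n`, `m` and `|V₂|` by four in total,
so the defect `|V₂| - 2(m - n + 2)` is additive. One direction is then arithmetic. The other needs
the defect to be nonnegative for all minimal graphs (`le_ncard_degreeTwoSet`), which is the bulk of
the proof. It is shown one colour class at a time, as total weight at most `-2` over the class
(`MinimalExpanding.sum_weight_le`), by induction on `#A`. Minimality gives each edge a certificate,
a set of excess one in which the edge is the only access to its end in `B`; submodularity of `T ↦
#(T.biUnion N)` uncrosses such sets. At a vertex `a` of degree at least three, one of three things
happens. Some neighbour of `a` has degree two with its other neighbour also of degree at least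
three, and is bicontracted. Or a minimal certificate omits at least two vertices, and the relation
is cut along it. Or every certificate omits one vertex, and `a` with the omitted vertices has total
weight exactly `-2`. -/

namespace BipartiteExpansion

open Finset

set_option linter.unusedSectionVars false

variable {α β : Type*} [DecidableEq α] [DecidableEq β]

/-! ### Expanding relations, tight sets and certificates -/

/-- A bipartite relation between `A` and `B`, given by the neighbourhoods `N a` of the members of
`A`, in which every nonempty proper subset `T` of `A` has more than `#T` neighbours. -/
structure Expanding (A : Finset α) (B : Finset β) (N : α → Finset β) : Prop where
  two_le : 2 ≤ #A
  card_eq : #A = #B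
  subset : ∀ a ∈ A, N a ⊆ B
  lt_card : ∀ T ⊆ A, T.Nonempty → T ≠ A → #T + 1 ≤ #(T.biUnion N)

/-- A proper subset of `A` with excess one. -/
structure Tight (A : Finset α) (N : α → Finset β) (S : Finset α) : Prop where
  subset : S ⊆ A
  ne : S ≠ A
  card_eq : #(S.biUnion N) = #S + 1

/-- `S` witnesses that removing `b` from `N a` destroys expansion. -/
structure Certifies (A : Finset α) (N : α → Finset β) (a : α) (b : β) (S : Finset α) : Prop
    extends Tight A N S where
  mem : a ∈ S
  eq_of_mem : ∀ x ∈ S, b ∈ N x → x = a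

/-- Expansion is destroyed by the removal of any edge. -/
structure MinimalExpanding (A : Finset α) (B : Finset β) (N : α → Finset β) : Prop
    extends Expanding A B N where
  exists_certifies : ∀ a ∈ A, ∀ b ∈ N a, ∃ S, Certifies A N a b S

/-- The contribution of a vertex of degree `d` to the inequality `m - n - |A₂| ≤ -2`. -/
def weight (d : ℕ) : ℤ := if d = 2 then -1 else (d : ℤ) - 2

lemma weight_two : weight 2 = -1 := rfl

lemma weight_of_three_le {d : ℕ} (h : 3 ≤ d) : weight d = d - 2 := if_neg (by omega)

lemma neg_one_le_weight {d : ℕ} (h : 2 ≤ d) : -1 ≤ weight d := by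
  unfold weight; split_ifs <;> omega

variable {A : Finset α} {B : Finset β} {N : α → Finset β}

namespace Expanding

lemma two_le_card (h : Expanding A B N) {a : α} (ha : a ∈ A) : 2 ≤ #(N a) := by
  have := h.lt_card {a} (by simpa) (by simp) (by
    rintro rfl
    have := h.two_le
    simp at this)
  simpa using this

lemma biUnion_subset (h : Expanding A B N) {S : Finset α} (hS : S ⊆ A) : S.biUnion N ⊆ B :=
  Finset.biUnion_subset.2 fun a ha ↦ h.subset a (hS ha)

/-- Expansion of `A.erase a` yields `#A = #B` neighbours, which is all of `B`. -/
lemma biUnion_erase (h : Expanding A B N) {a : α} (ha : a ∈ A) : (A.erase a).biUnion N = B := by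
  have h2 := h.two_le
  have hc := card_erase_of_mem ha
  refine eq_of_subset_of_card_le (h.biUnion_subset (erase_subset _ _)) ?_
  have := h.lt_card _ (erase_subset a A) (card_pos.1 (by omega)) (fun h ↦ by
    rw [h] at hc; omega)
  have := h.card_eq
  omega

lemma exists_ne (h : Expanding A B N) {b : β} (hb : b ∈ B) {a : α} (ha : a ∈ A) :
    ∃ x ∈ A, x ≠ a ∧ b ∈ N x := by
  rw [← h.biUnion_erase ha] at hb
  obtain ⟨x, hx, hbx⟩ := mem_biUnion.1 hb
  exact ⟨x, mem_of_mem_erase hx, ne_of_mem_erase hx, hbx⟩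

lemma biUnion_eq (h : Expanding A B N) : A.biUnion N = B := by
  refine (h.biUnion_subset subset_rfl).antisymm fun b hb ↦ ?_
  obtain ⟨a, ha⟩ := card_pos.1 (show 0 < #A by have := h.two_le; omega)
  obtain ⟨x, hx, -, hbx⟩ := h.exists_ne hb ha
  exact mem_biUnion.2 ⟨x, hx, hbx⟩

end Expanding

lemma biUnion_inter_subset (S T : Finset α) :
    (S ∩ T).biUnion N ⊆ S.biUnion N ∩ T.biUnion N :=
  subset_inter (biUnion_subset_biUnion_of_subset_left _ inter_subset_left)
    (biUnion_subset_biUnion_of_subset_left _ inter_subset_right)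

lemma card_biUnion_union_add (S T : Finset α) :
    #((S ∪ T).biUnion N) + #(S.biUnion N ∩ T.biUnion N) = #(S.biUnion N) + #(T.biUnion N) := by
  rw [union_biUnion, card_union_add_card_inter]

lemma Tight.nonempty_sdiff {S : Finset α} (hS : Tight A N S) : (A \ S).Nonempty :=
  sdiff_nonempty.2 fun h ↦ hS.ne (hS.subset.antisymm h)

/-! ### Uncrossing -/

section uncrossing

variable {S T : Finset α}

lemma Tight.inter_ne (hS : Tight A N S) : S ∩ T ≠ A :=
  fun h ↦ hS.ne (hS.subset.antisymm (h ▸ inter_subset_left))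

/-- By submodularity the excesses of `S ∩ T` and `S ∪ T` sum to at most two. Expansion demands at
least one from each, so every inequality on the way is an equality. -/
lemma Tight.uncross (h : Expanding A B N) (hS : Tight A N S) (hT : Tight A N T)
    (hi : (S ∩ T).Nonempty) (hu : S ∪ T ≠ A) :
    Tight A N (S ∩ T) ∧ Tight A N (S ∪ T) ∧
      (S ∩ T).biUnion N = S.biUnion N ∩ T.biUnion N := by
  have h1 := h.lt_card _ (inter_subset_left.trans hS.subset) hi hS.inter_ne
  have h2 := h.lt_card _ (union_subset hS.subset hT.subset) (hi.mono inter_subset_union) hu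
  have h3 := card_biUnion_union_add (N := N) S T
  have h4 := card_le_card (biUnion_inter_subset (N := N) S T)
  have h5 := card_union_add_card_inter S T
  have h6 := hS.card_eq
  have h7 := hT.card_eq
  exact ⟨⟨inter_subset_left.trans hS.subset, hS.inter_ne, by omega⟩,
    ⟨union_subset hS.subset hT.subset, hu, by omega⟩,
    eq_of_subset_of_card_le (biUnion_inter_subset S T) (by omega)⟩

/-- Two certificates at a vertex of degree at least three together cover `A`. -/
lemma Certifies.union_eq (h : Expanding A B N) {a : α} {b b' : β} (ha : 3 ≤ #(N a))
    (hb : b ∈ N a) (hb' : b' ∈ N a) (hne : b ≠ b') (hS : Certifies A N a b S)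
    (hT : Certifies A N a b' T) : S ∪ T = A := by
  by_contra hu
  have haST : a ∈ S ∩ T := mem_inter.2 ⟨hS.mem, hT.mem⟩
  obtain ⟨hi, -, -⟩ := hS.toTight.uncross h hT.toTight ⟨a, haST⟩ hu
  -- Removing `a` from the tight set `S ∩ T` loses both `b` and `b'`, leaving no more neighbours
  -- than vertices. This violates expansion unless `S ∩ T = {a}`, and then tightness forces `a` to
  -- have degree two.
  have hsub : ((S ∩ T).erase a).biUnion N ⊆ (((S ∩ T).biUnion N).erase b).erase b' := by
    intro y hy
    obtain ⟨x, hx, hyx⟩ := mem_biUnion.1 hy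
    obtain ⟨hxa, hx⟩ := mem_erase.1 hx
    obtain ⟨hxS, hxT⟩ := mem_inter.1 hx
    refine mem_erase.2 ⟨?_, mem_erase.2 ⟨?_, mem_biUnion.2 ⟨x, hx, hyx⟩⟩⟩
    · rintro rfl; exact hxa (hT.eq_of_mem x hxT hyx)
    · rintro rfl; exact hxa (hS.eq_of_mem x hxS hyx)
  have hbm : b ∈ (S ∩ T).biUnion N := mem_biUnion.2 ⟨a, haST, hb⟩
  have hbm' : b' ∈ ((S ∩ T).biUnion N).erase b :=
    mem_erase.2 ⟨hne.symm, mem_biUnion.2 ⟨a, haST, hb'⟩⟩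
  have h1 := card_le_card hsub
  rw [card_erase_of_mem hbm', card_erase_of_mem hbm, hi.card_eq] at h1
  have h2 := card_erase_of_mem haST
  have h2' := card_pos.2 ⟨a, haST⟩
  rcases ((S ∩ T).erase a).eq_empty_or_nonempty with h0 | h0
  · have hc : S ∩ T = {a} := by
      rw [← insert_erase haST, h0]; rfl
    have := hi.card_eq
    rw [hc] at this
    simp at this
    omega
  · have := h.lt_card _ ((erase_subset _ _).trans hi.subset) h0 (fun h' ↦ by
      have := h' ▸ hi.subset haST
      simp at this)
    omega

/-- If the edge certified by `T` leaves the complement of the tight set `S`, then `S` and `T`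
do not cross. -/
lemma Certifies.of_leaving (h : Expanding A B N) {r : α} {b : β} (hb : b ∈ N r)
    (hT : Certifies A N r b T) (hS : Tight A N S) (hr : r ∉ S) (hbS : b ∈ S.biUnion N)
    (hi : (S ∩ T).Nonempty) : S ∪ T = A ∧ Tight A N (S ∩ T) := by
  have hbi : b ∈ S.biUnion N ∩ T.biUnion N :=
    mem_inter.2 ⟨hbS, mem_biUnion.2 ⟨r, hT.mem, hb⟩⟩
  have hbn : b ∉ (S ∩ T).biUnion N := by
    intro hm
    obtain ⟨x, hx, hbx⟩ := mem_biUnion.1 hm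
    obtain ⟨hxS, hxT⟩ := mem_inter.1 hx
    exact hr (hT.eq_of_mem x hxT hbx ▸ hxS)
  have hu : S ∪ T = A := by
    by_contra hu
    obtain ⟨-, -, he⟩ := hS.uncross h hT.toTight hi hu
    exact hbn (he ▸ hbi)
  refine ⟨hu, inter_subset_left.trans hS.subset, hS.inter_ne, ?_⟩
  -- When `S ∪ T = A`, the common neighbourhood has `#(S ∩ T) + 2` members. As `b` is one of them
  -- and is not seen from `S ∩ T`, the latter has excess at most one.
  have h1 := h.lt_card _ (inter_subset_left.trans hS.subset) hi hS.inter_ne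
  have h3 := card_biUnion_union_add (N := N) S T
  have h4 := card_lt_card ((ssubset_iff_of_subset (biUnion_inter_subset (N := N) S T)).2
    ⟨b, hbi, hbn⟩)
  have h5 := card_union_add_card_inter S T
  have h6 := hS.card_eq
  have h7 := hT.card_eq
  rw [hu, h.biUnion_eq, ← h.card_eq] at h3
  rw [hu] at h5
  omega

end uncrossing

/-! ### Contractions and the weight inequality -/

/-- If all removable edges are incident with `a₀`, deleting edges at `a₀` gives a minimal
expanding relation. -/
lemma Expanding.exists_minimal (h : Expanding A B N) {a₀ : α}
    (hcert : ∀ a ∈ A, a ≠ a₀ → ∀ b ∈ N a, ∃ S, Certifies A N a b S) :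
    ∃ N' : α → Finset β, MinimalExpanding A B N' ∧ ∀ a, a ≠ a₀ → N' a = N a := by
  -- Each round deletes one uncertified edge at `a₀`. Certificates of other edges survive: deletion
  -- only shrinks neighbourhoods, and expansion stops them at `#S + 1`.
  induction hk : #(N a₀) using Nat.strong_induction_on generalizing N with
  | _ k ih =>
  by_cases hall : a₀ ∈ A → ∀ b ∈ N a₀, ∃ S, Certifies A N a₀ b S
  · refine ⟨N, ⟨h, fun a ha b hb ↦ ?_⟩, fun _ _ ↦ rfl⟩
    by_cases haa : a = a₀
    · subst haa; exact hall ha b hb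
    · exact hcert a ha haa b hb
  push Not at hall
  obtain ⟨ha₀, b, hb, hno⟩ := hall
  set N' : α → Finset β := Function.update N a₀ ((N a₀).erase b) with hN'
  have hN'a : N' a₀ = (N a₀).erase b := by simp [N']
  have hN'n : ∀ a, a ≠ a₀ → N' a = N a := fun a ha ↦ by simp [N', ha]
  have hle : ∀ a, N' a ⊆ N a := fun a ↦ by
    by_cases haa : a = a₀
    · subst haa; rw [hN'a]; exact erase_subset _ _
    · rw [hN'n a haa]
  have hsub : ∀ T : Finset α, T.biUnion N' ⊆ T.biUnion N := fun T ↦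
    biUnion_mono fun a _ ↦ hle a
  have hback : ∀ T : Finset α, T.biUnion N ⊆ insert b (T.biUnion N') := by
    intro T y hy
    obtain ⟨x, hx, hyx⟩ := mem_biUnion.1 hy
    by_cases hyb : y = b
    · exact mem_insert.2 (.inl hyb)
    refine mem_insert_of_mem (mem_biUnion.2 ⟨x, hx, ?_⟩)
    by_cases hxa : x = a₀
    · subst hxa; rw [hN'a]; exact mem_erase.2 ⟨hyb, hyx⟩
    · rwa [hN'n x hxa]
  have hexp : Expanding A B N' := by
    refine ⟨h.two_le, h.card_eq, fun a ha ↦ (hle a).trans (h.subset a ha), fun T hT hT0 hTA ↦ ?_⟩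
    have h1 := h.lt_card T hT hT0 hTA
    have h2 := card_le_card (hback T)
    have h3 := card_insert_le b (T.biUnion N')
    -- A set violating expansion after the deletion was tight and has lost `b`. If it contains `a₀`
    -- it is an excluded certificate; otherwise its neighbourhood has not changed.
    by_contra hlt
    have htight : Tight A N T := ⟨hT, hTA, by omega⟩
    have hbn : b ∉ T.biUnion N' := fun hbm ↦ by
      rw [insert_eq_of_mem hbm] at h2; omega
    have hpriv : ∀ x ∈ T, b ∈ N x → x = a₀ := by
      intro x hx hbx
      by_contra hxa
      exact hbn (mem_biUnion.2 ⟨x, hx, by rwa [hN'n x hxa]⟩)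
    by_cases haT : a₀ ∈ T
    · exact hno T ⟨htight, haT, hpriv⟩
    · have : T.biUnion N' = T.biUnion N := biUnion_congr rfl fun x hx ↦
        hN'n x fun hxa ↦ haT (hxa ▸ hx)
      rw [this] at hlt
      omega
  have hpos := card_pos.2 ⟨b, hb⟩
  obtain ⟨N'', hmin, hag⟩ := ih #(N' a₀) (by rw [hN'a, card_erase_of_mem hb]; omega) hexp
    (fun a ha haa b' hb' ↦ by
      rw [hN'n a haa] at hb'
      obtain ⟨S, hS⟩ := hcert a ha haa b' hb'
      refine ⟨S, ⟨⟨hS.subset, hS.ne, ?_⟩, hS.mem, fun x hx hbx ↦ hS.eq_of_mem x hx (hle x hbx)⟩⟩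
      have h1 := hexp.lt_card S hS.subset ⟨a, hS.mem⟩ hS.ne
      have h2 := card_le_card (hsub S)
      have h3 := hS.card_eq
      omega) rfl
  exact ⟨N'', hmin, fun a ha ↦ (hag a ha).trans (hN'n a ha)⟩

/-- Contraction of the complement of a tight set. -/
lemma sum_weight_tight_le (h : MinimalExpanding A B N) {S : Finset α} (hS : Tight A N S)
    (hS0 : S.Nonempty) (hlt : #S + 1 < #A)
    (ih : ∀ (A' : Finset α) (B' : Finset β) (N' : α → Finset β), #A' < #A →
      MinimalExpanding A' B' N' → ∑ a ∈ A', weight #(N' a) ≤ -2) :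
    ∑ a ∈ S, weight #(N a) ≤ -1 := by
  obtain ⟨a₀, ha₀⟩ := hS.nonempty_sdiff
  obtain ⟨ha₀A, ha₀S⟩ := mem_sdiff.1 ha₀
  -- The vertex `a₀` stands for the whole of `A \ S`, seen from `S.biUnion N`.
  set N' : α → Finset β :=
    Function.update N a₀ ((A \ S).biUnion N ∩ S.biUnion N) with hN'
  have hN'a : N' a₀ = (A \ S).biUnion N ∩ S.biUnion N := by simp [N']
  have hN'n : ∀ a, a ≠ a₀ → N' a = N a := fun a ha ↦ by simp [N', ha]
  have hN'S : ∀ T ⊆ S, T.biUnion N' = T.biUnion N := fun T hT ↦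
    biUnion_congr rfl fun x hx ↦ hN'n x fun hxa ↦ ha₀S (hxa ▸ hT hx)
  have hcards : #(A \ S) + #S = #A := card_sdiff_add_card_eq_card hS.subset
  have hexp : Expanding (insert a₀ S) (S.biUnion N) N' := by
    refine ⟨?_, ?_, ?_, ?_⟩
    · rw [card_insert_of_notMem ha₀S]
      have := card_pos.2 hS0
      omega
    · rw [card_insert_of_notMem ha₀S, hS.card_eq]
    · intro a ha
      rcases mem_insert.1 ha with rfl | ha
      · rw [hN'a]; exact inter_subset_right
      · rw [hN'n a (fun hxa ↦ ha₀S (hxa ▸ ha))]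
        exact subset_biUnion_of_mem N ha
    · intro T hT hT0 hTA
      by_cases haT : a₀ ∈ T
      · set T₀ := T.erase a₀ with hT₀
        have hTins : T = insert a₀ T₀ := (insert_erase haT).symm
        have hT₀S : T₀ ⊆ S := by
          intro x hx
          exact (mem_insert.1 (hT (mem_of_mem_erase hx))).resolve_left (ne_of_mem_erase hx)
        have hT₀ne : T₀ ≠ S := fun h' ↦ hTA (by rw [hTins, h'])
        have hdisj : Disjoint T₀ (A \ S) := disjoint_sdiff.mono_left hT₀S
        have hu : T₀ ∪ (A \ S) ≠ A := by
          intro hA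
          apply hT₀ne
          refine hT₀S.antisymm fun x hx ↦ ?_
          rw [← hA] at hS
          exact (mem_union.1 (hS.subset hx)).resolve_right fun h' ↦ (mem_sdiff.1 h').2 hx
        -- Only `#(A \ S) - 1` members of `B` lie outside `S.biUnion N`, so at least `#T₀ + 2 = #T +
        -- 1` of the neighbours guaranteed here remain in the contraction.
        have h1 := h.lt_card (T₀ ∪ (A \ S)) (union_subset (hT₀S.trans hS.subset) sdiff_subset)
          ⟨a₀, mem_union_right _ ha₀⟩ hu
        have h2 : (T₀ ∪ (A \ S)).biUnion N ⊆ T.biUnion N' ∪ (B \ S.biUnion N) := by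
          intro y hy
          have hyB : y ∈ B := h.biUnion_subset
            (union_subset (hT₀S.trans hS.subset) sdiff_subset) hy
          by_cases hyS : y ∈ S.biUnion N
          · refine mem_union_left _ ?_
            rw [union_biUnion, mem_union] at hy
            rcases hy with hy | hy
            · rw [hTins, biUnion_insert, hN'S _ hT₀S]
              exact mem_union_right _ hy
            · exact mem_biUnion.2 ⟨a₀, haT, by rw [hN'a]; exact mem_inter.2 ⟨hy, hyS⟩⟩
          · exact mem_union_right _ (mem_sdiff.2 ⟨hyB, hyS⟩)
        have h3 := (card_le_card h2).trans (card_union_le _ _)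
        have h4 := card_sdiff_add_card_eq_card (h.biUnion_subset hS.subset)
        have h5 := card_union_of_disjoint hdisj
        have h6 := hS.card_eq
        have h7 := h.card_eq
        have h8 : #T = #T₀ + 1 := by
          rw [hTins, card_insert_of_notMem (by simp [T₀])]
        omega
      · have hTS : T ⊆ S := fun x hx ↦
          (mem_insert.1 (hT hx)).resolve_left fun hxa ↦ haT (hxa ▸ hx)
        rw [hN'S T hTS]
        refine h.lt_card T (hTS.trans hS.subset) hT0 fun hA ↦ haT (hA ▸ ha₀A)
  have hcert : ∀ a ∈ insert a₀ S, a ≠ a₀ → ∀ b ∈ N' a,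
      ∃ T, Certifies (insert a₀ S) N' a b T := by
    intro a ha haa b hb
    have haS : a ∈ S := (mem_insert.1 ha).resolve_left haa
    rw [hN'n a haa] at hb
    obtain ⟨T, hT⟩ := h.exists_certifies a (hS.subset haS) b hb
    have hi : (S ∩ T).Nonempty := ⟨a, mem_inter.2 ⟨haS, hT.mem⟩⟩
    -- If `T` contains all of `A \ S`, then `a₀` replaces that part of `T`; otherwise uncrossing
    -- lets `S ∩ T` serve as certificate.
    by_cases hu : S ∪ T = A
    · have hRT : A \ S ⊆ T := by
        intro x hx
        obtain ⟨hxA, hxS⟩ := mem_sdiff.1 hx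
        rw [← hu] at hxA
        exact (mem_union.1 hxA).resolve_left hxS
      have hne : insert a₀ (S ∩ T) ≠ insert a₀ S := by
        intro he
        apply hT.ne
        rw [← hu, eq_comm, union_eq_right]
        intro x hx
        have : x ∈ insert a₀ (S ∩ T) := he ▸ mem_insert_of_mem hx
        rcases mem_insert.1 this with rfl | h'
        · exact (ha₀S hx).elim
        · exact (mem_inter.1 h').2
      have hsub : insert a₀ (S ∩ T) ⊆ insert a₀ S := insert_subset_insert _ inter_subset_left
      have hnot : a₀ ∉ S ∩ T := fun h' ↦ ha₀S (mem_inter.1 h').1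
      refine ⟨insert a₀ (S ∩ T), ⟨⟨hsub, hne, ?_⟩, mem_insert_of_mem (mem_inter.2 ⟨haS, hT.mem⟩),
        fun x hx hbx ↦ ?_⟩⟩
      · have h1 := hexp.lt_card _ hsub (insert_nonempty _ _) hne
        have h2 : (insert a₀ (S ∩ T)).biUnion N' ⊆ S.biUnion N ∩ T.biUnion N := by
          rw [biUnion_insert, hN'a, hN'S _ inter_subset_left]
          refine union_subset ?_ (biUnion_inter_subset S T)
          rw [inter_comm]
          exact inter_subset_inter_left (biUnion_subset_biUnion_of_subset_left _ hRT)
        have h2' := card_le_card h2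
        have h3 := card_biUnion_union_add (N := N) S T
        have h5 := card_union_add_card_inter S T
        have h6 := hS.card_eq
        have h7 := hT.card_eq
        rw [hu, h.biUnion_eq, ← h.card_eq] at h3
        rw [hu] at h5
        rw [card_insert_of_notMem hnot] at h1 ⊢
        omega
      · rcases mem_insert.1 hx with rfl | hx
        · rw [hN'a] at hbx
          obtain ⟨y, hy, hby⟩ := mem_biUnion.1 (mem_inter.1 hbx).1
          have := hT.eq_of_mem y (hRT hy) hby
          subst this
          exact ((mem_sdiff.1 hy).2 haS).elim
        · obtain ⟨hxS, hxT⟩ := mem_inter.1 hx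
          rw [hN'n x (fun hxa ↦ ha₀S (hxa ▸ hxS))] at hbx
          exact hT.eq_of_mem x hxT hbx
    · obtain ⟨ht, -, -⟩ := hS.uncross h.toExpanding hT.toTight hi hu
      refine ⟨S ∩ T, ⟨⟨inter_subset_left.trans (subset_insert _ _), fun he ↦ ?_, ?_⟩,
        mem_inter.2 ⟨haS, hT.mem⟩, fun x hx hbx ↦ ?_⟩⟩
      · have : a₀ ∈ S ∩ T := he ▸ mem_insert_self _ _
        exact ha₀S (mem_inter.1 this).1
      · rw [hN'S _ inter_subset_left, ht.card_eq]
      · obtain ⟨hxS, hxT⟩ := mem_inter.1 hx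
        rw [hN'n x (fun hxa ↦ ha₀S (hxa ▸ hxS))] at hbx
        exact hT.eq_of_mem x hxT hbx
  -- Only edges at `a₀` can be removable, so thinning them leaves the degrees in `S` alone. Of the
  -- total `-2`, the vertex `a₀` accounts for at least `-1`.
  obtain ⟨N'', hmin, hag⟩ := hexp.exists_minimal hcert
  have h1 := ih _ _ _ (by rw [card_insert_of_notMem ha₀S]; exact hlt) hmin
  rw [sum_insert ha₀S] at h1
  have h2 := neg_one_le_weight (hmin.two_le_card (mem_insert_self a₀ S))
  have h3 : ∑ a ∈ S, weight #(N'' a) = ∑ a ∈ S, weight #(N a) :=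
    sum_congr rfl fun x hx ↦ by
      have hxa : x ≠ a₀ := fun hxa ↦ ha₀S (hxa ▸ hx)
      rw [hag x hxa, hN'n x hxa]
  linarith

/-- Contraction of a vertex `b` of degree two whose two neighbours have degree at least three. -/
lemma sum_weight_le_of_bicontraction (h : MinimalExpanding A B N) {a r : α} {b : β}
    (haA : a ∈ A) (hrA : r ∈ A) (har : a ≠ r) (ha : 3 ≤ #(N a)) (hr : 3 ≤ #(N r))
    (hba : b ∈ N a) (hbr : b ∈ N r) (hb : ∀ x ∈ A, b ∈ N x → x = a ∨ x = r)
    (ih : ∀ (A' : Finset α) (B' : Finset β) (N' : α → Finset β), #A' < #A →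
      MinimalExpanding A' B' N' → ∑ a ∈ A', weight #(N' a) ≤ -2) :
    ∑ a ∈ A, weight #(N a) ≤ -2 := by
  -- A certificate of `xb` omits `x'`, which also sees `b`. Two certificates at `x` cover `A`, so
  -- any certificate of another edge at `x` contains `x'`.
  have hpriv : ∀ (x x' : α), x ∈ A → 3 ≤ #(N x) → b ∈ N x → x' ∈ A → b ∈ N x' → x ≠ x' →
      ∀ y ∈ N x, y ≠ b → ∀ T, Certifies A N x y T → x' ∈ T := by
    intro x x' hx hx3 hbx hx' hbx' hne y hy hyb T hT
    obtain ⟨S, hS⟩ := h.exists_certifies x hx b hbx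
    have hu := hS.union_eq h.toExpanding hx3 hbx hy hyb.symm hT
    rw [← hu] at hx'
    exact (mem_union.1 hx').resolve_left fun h' ↦ hne (hS.eq_of_mem x' h' hbx').symm
  have hcommon : ∀ y ∈ N a, y ∈ N r → y = b := by
    intro y hya hyr
    by_contra hyb
    obtain ⟨T, hT⟩ := h.exists_certifies a haA y hya
    have := hpriv a r haA ha hba hrA hbr har y hya hyb T hT
    exact har (hT.eq_of_mem r this hyr).symm
  -- The vertices `a`, `b`, `r` merge into one, still called `a`.
  set N' : α → Finset β := Function.update N a ((N a ∪ N r).erase b) with hN'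
  have hN'a : N' a = (N a ∪ N r).erase b := by simp [N']
  have hN'n : ∀ x, x ≠ a → N' x = N x := fun x hx ↦ by simp [N', hx]
  have hbB : b ∈ B := h.subset a haA hba
  have hN'T : ∀ T : Finset α, a ∉ T → T.biUnion N' = T.biUnion N := fun T hT ↦
    biUnion_congr rfl fun x hx ↦ hN'n x fun hxa ↦ hT (hxa ▸ hx)
  have hN'T' : ∀ T ⊆ A, a ∈ T → r ∈ T → (T.erase r).biUnion N' = (T.biUnion N).erase b := by
    intro T hTA haT hrT
    ext y
    simp only [mem_biUnion, mem_erase]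
    constructor
    · rintro ⟨x, ⟨hxr, hxT⟩, hy⟩
      by_cases hxa : x = a
      · subst hxa
        rw [hN'a, mem_erase, mem_union] at hy
        exact ⟨hy.1, hy.2.elim (fun h' ↦ ⟨x, hxT, h'⟩) fun h' ↦ ⟨r, hrT, h'⟩⟩
      · rw [hN'n x hxa] at hy
        refine ⟨?_, x, hxT, hy⟩
        rintro rfl
        exact (hb x (hTA hxT) hy).elim hxa hxr
    · rintro ⟨hyb, x, hxT, hy⟩
      by_cases hxr : x = r
      · subst hxr
        exact ⟨a, ⟨har, haT⟩, by rw [hN'a]; exact mem_erase.2 ⟨hyb, mem_union_right _ hy⟩⟩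
      · refine ⟨x, ⟨hxr, hxT⟩, ?_⟩
        by_cases hxa : x = a
        · subst hxa; rw [hN'a]; exact mem_erase.2 ⟨hyb, mem_union_left _ hy⟩
        · rwa [hN'n x hxa]
  have hcr := card_erase_of_mem hrA
  have hcb := card_erase_of_mem hbB
  have hA3 : 3 ≤ #A := by
    rw [h.card_eq]; exact ha.trans (card_le_card (h.subset a haA))
  have hexp : Expanding (A.erase r) (B.erase b) N' := by
    refine ⟨by omega, by rw [hcr, hcb, h.card_eq], ?_, ?_⟩
    · intro x hx
      obtain ⟨hxr, hxA⟩ := mem_erase.1 hx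
      by_cases hxa : x = a
      · subst hxa
        rw [hN'a]
        exact erase_subset_erase _ (union_subset (h.subset x hxA) (h.subset r hrA))
      · rw [hN'n x hxa]
        intro y hy
        refine mem_erase.2 ⟨?_, h.subset x hxA hy⟩
        rintro rfl
        exact (hb x hxA hy).elim hxa hxr
    · intro T hT hT0 hTA
      have hrT : r ∉ T := fun h' ↦ by simpa using hT h'
      have hTA' : T ⊆ A := hT.trans (erase_subset _ _)
      by_cases haT : a ∈ T
      · have hne : insert r T ≠ A := fun h' ↦ hTA (by rw [← h', erase_insert hrT])
        have h1 := h.lt_card (insert r T) (insert_subset hrA hTA') (insert_nonempty _ _) hne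
        have h2 := hN'T' (insert r T) (insert_subset hrA hTA') (mem_insert_of_mem haT)
          (mem_insert_self _ _)
        rw [erase_insert hrT] at h2
        rw [h2, card_erase_of_mem (mem_biUnion.2 ⟨r, mem_insert_self _ _, hbr⟩)]
        rw [card_insert_of_notMem hrT] at h1
        omega
      · rw [hN'T T haT]
        exact h.lt_card T hTA' hT0 fun h' ↦ haT (h' ▸ haA)
  have hlift : ∀ (x : α) (y : β) (T : Finset α), y ≠ b → a ∈ T → r ∈ T → x ∈ T.erase r →
      Tight A N T → (∀ z ∈ T.erase r, y ∈ N' z → z = x) →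
      Certifies (A.erase r) N' x y (T.erase r) := by
    intro x y T hyb haT hrT hx hT hz
    refine ⟨⟨erase_subset_erase _ hT.subset, fun he ↦ hT.ne ?_, ?_⟩, hx, hz⟩
    · rw [← insert_erase hrT, he, insert_erase hrA]
    · rw [hN'T' T hT.subset haT hrT, card_erase_of_mem (mem_biUnion.2 ⟨r, hrT, hbr⟩), hT.card_eq,
        card_erase_of_mem hrT]
      have := card_pos.2 ⟨r, hrT⟩
      omega
  -- A certificate containing just one of `a` and `r` can shed it: that vertex is its only access to
  -- `b`, so size and neighbourhood both drop by one.
  have hdrop : ∀ (x z : α) (y : β) (T : Finset α), x ≠ z → b ∈ N z →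
      Certifies A N x y T → z ∈ T → (∀ x' ∈ T, b ∈ N x' → x' = z) →
      Certifies A N x y (T.erase z) := by
    intro x z y T hxz hbz hT hz hb'
    have hxm : x ∈ T.erase z := mem_erase.2 ⟨hxz, hT.mem⟩
    have hsub : T.erase z ⊆ A := (erase_subset _ _).trans hT.subset
    have hne : T.erase z ≠ A := fun h' ↦ by
      have := h' ▸ hT.subset hz
      simp at this
    refine ⟨⟨hsub, hne, ?_⟩, hxm, fun w hw ↦ hT.eq_of_mem w (mem_of_mem_erase hw)⟩
    have h1 := h.lt_card _ hsub ⟨x, hxm⟩ hne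
    have h2 : (T.erase z).biUnion N ⊆ (T.biUnion N).erase b := by
      intro w hw
      obtain ⟨x', hx', hwx⟩ := mem_biUnion.1 hw
      refine mem_erase.2 ⟨?_, mem_biUnion.2 ⟨x', mem_of_mem_erase hx', hwx⟩⟩
      rintro rfl
      exact ne_of_mem_erase hx' (hb' x' (mem_of_mem_erase hx') hwx)
    have h3 := card_le_card h2
    rw [card_erase_of_mem (mem_biUnion.2 ⟨z, hz, hbz⟩), hT.card_eq] at h3
    rw [card_erase_of_mem hz] at h1 ⊢
    omega
  have hmin : MinimalExpanding (A.erase r) (B.erase b) N' := by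
    refine ⟨hexp, fun x hx y hy ↦ ?_⟩
    obtain ⟨hxr, hxA⟩ := mem_erase.1 hx
    by_cases hxa : x = a
    · subst hxa
      rw [hN'a, mem_erase, mem_union] at hy
      obtain ⟨hyb, hy⟩ := hy
      rcases hy with hy | hy
      · obtain ⟨T, hT⟩ := h.exists_certifies x hxA y hy
        have hrT := hpriv x r hxA ha hba hrA hbr har y hy hyb T hT
        refine ⟨_, hlift x y T hyb hT.mem hrT (mem_erase.2 ⟨har, hT.mem⟩) hT.toTight ?_⟩
        intro z hz hyz
        by_contra hzx
        rw [hN'n z hzx] at hyz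
        exact hzx (hT.eq_of_mem z (mem_of_mem_erase hz) hyz)
      · obtain ⟨T, hT⟩ := h.exists_certifies r hrA y hy
        have haT := hpriv r x hrA hr hbr hxA hba har.symm y hy hyb T hT
        refine ⟨_, hlift x y T hyb haT hT.mem (mem_erase.2 ⟨har, haT⟩) hT.toTight ?_⟩
        intro z hz hyz
        by_contra hzx
        rw [hN'n z hzx] at hyz
        exact ne_of_mem_erase hz (hT.eq_of_mem z (mem_of_mem_erase hz) hyz)
    · rw [hN'n x hxa] at hy
      have hyb : y ≠ b := by
        rintro rfl
        exact (hb x hxA hy).elim hxa hxr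
      have hfree : ∀ T, Certifies A N x y T → a ∉ T → r ∉ T →
          Certifies (A.erase r) N' x y T := by
        intro T hT haT hrT
        refine ⟨⟨fun z hz ↦ mem_erase.2 ⟨fun h' ↦ hrT (h' ▸ hz), hT.subset hz⟩, fun he ↦ ?_, ?_⟩,
          hT.mem, fun z hz hyz ↦ ?_⟩
        · exact haT (he ▸ mem_erase.2 ⟨har, haA⟩)
        · rw [hN'T T haT, hT.card_eq]
        · rw [hN'n z fun h' ↦ haT (h' ▸ hz)] at hyz
          exact hT.eq_of_mem z hz hyz
      obtain ⟨T, hT⟩ := h.exists_certifies x hxA y hy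
      by_cases haT : a ∈ T <;> by_cases hrT : r ∈ T
      · refine ⟨_, hlift x y T hyb haT hrT (mem_erase.2 ⟨hxr, hT.mem⟩) hT.toTight ?_⟩
        intro z hz hyz
        by_cases hza : z = a
        · subst hza
          rw [hN'a, mem_erase, mem_union] at hyz
          rcases hyz.2 with h' | h'
          · exact hT.eq_of_mem z haT h'
          · exact (hxr (hT.eq_of_mem r hrT h').symm).elim
        · rw [hN'n z hza] at hyz
          exact hT.eq_of_mem z (mem_of_mem_erase hz) hyz
      · refine ⟨_, hfree _ (hdrop x a y T hxa hba hT haT fun x' hx' hbx' ↦ ?_) (by simp)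
          fun h' ↦ hrT (mem_of_mem_erase h')⟩
        exact (hb x' (hT.subset hx') hbx').resolve_right fun h' ↦ hrT (h' ▸ hx')
      · refine ⟨_, hfree _ (hdrop x r y T hxr hbr hT hrT fun x' hx' hbx' ↦ ?_)
          (fun h' ↦ haT (mem_of_mem_erase h')) (by simp)⟩
        exact (hb x' (hT.subset hx') hbx').resolve_left fun h' ↦ haT (h' ▸ hx')
      · exact ⟨T, hfree T hT haT hrT⟩
  have h1 := ih _ _ _ (by omega) hmin
  have haE : a ∈ A.erase r := mem_erase.2 ⟨har, haA⟩
  rw [← add_sum_erase _ _ haE] at h1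
  rw [← add_sum_erase _ _ hrA, ← add_sum_erase _ _ haE]
  have h2 : ∑ x ∈ (A.erase r).erase a, weight #(N' x) = ∑ x ∈ (A.erase r).erase a, weight #(N x) :=
    sum_congr rfl fun x hx ↦ by rw [hN'n x (ne_of_mem_erase hx)]
  -- The sole common neighbour `b` disappears, so the merged degree is the sum of the two minus two,
  -- hence at least four, and the weights `d - 2` add up exactly.
  have h3 : #(N' a) + 2 = #(N a) + #(N r) := by
    have hi : N a ∩ N r = {b} := by
      ext y
      simp only [mem_inter, mem_singleton]
      exact ⟨fun h' ↦ hcommon y h'.1 h'.2, by rintro rfl; exact ⟨hba, hbr⟩⟩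
    have := card_union_add_card_inter (N a) (N r)
    rw [hi, card_singleton] at this
    rw [hN'a, card_erase_of_mem (mem_union_left _ hba)]
    omega
  rw [weight_of_three_le (by omega)] at h1
  rw [weight_of_three_le ha, weight_of_three_le hr]
  linarith [show ((#(N' a) : ℤ) + 2) = #(N a) + #(N r) by exact_mod_cast h3]

/-- Contraction of `S` and its neighbourhood, for an inclusion-minimal certificate `S` of an edge. -/
lemma sum_weight_sdiff_le (h : MinimalExpanding A B N) {a : α} {b : β} {S : Finset α}
    (haA : a ∈ A) (hba : b ∈ N a) (hS : Certifies A N a b S)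
    (hSmin : ∀ T, Certifies A N a b T → T ⊆ S → T = S)
    (hdeg : ∀ r ∈ A, 3 ≤ #(N r) → b ∈ N r → r ≠ a → ∃ x ∈ A, b ∈ N x ∧ x ≠ a ∧ x ≠ r)
    (hR : 2 ≤ #(A \ S)) (hRt : #((A \ S).biUnion N) ≠ #(A \ S) + 1)
    (ih : ∀ (A' : Finset α) (B' : Finset β) (N' : α → Finset β), #A' < #A →
      MinimalExpanding A' B' N' → ∑ a ∈ A', weight #(N' a) ≤ -2) :
    ∑ a ∈ A \ S, weight #(N a) ≤ -2 := by
  have hbS : b ∈ S.biUnion N := mem_biUnion.2 ⟨a, hS.mem, hba⟩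
  have hbB : b ∈ B := h.subset a haA hba
  have hNSB : S.biUnion N ⊆ B := h.biUnion_subset hS.subset
  have hcards : #(A \ S) + #S = #A := card_sdiff_add_card_eq_card hS.subset
  have hcardU := card_sdiff_add_card_eq_card hNSB
  have hSc := hS.card_eq
  have hABc := h.card_eq
  -- `φ` collapses `S.biUnion N` to the single point `b`, and `S` itself is dropped. The counts
  -- below rest on `S` having one neighbour more than it has members.
  set φ : β → β := fun y ↦ if y ∈ S.biUnion N then b else y with hφ
  have hφS : ∀ y ∈ S.biUnion N, φ y = b := fun y hy ↦ if_pos hy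
  have hφn : ∀ y, y ∉ S.biUnion N → φ y = y := fun y hy ↦ if_neg hy
  have hφb : ∀ y, φ y = b → y ∈ S.biUnion N := fun y hy ↦ by
    by_contra hn
    rw [hφn y hn] at hy
    exact hn (hy ▸ hbS)
  have hφu : ∀ y z, z ∉ S.biUnion N → φ y = z → y = z := fun y z hz hy ↦ by
    by_cases hyS : y ∈ S.biUnion N
    · rw [hφS y hyS] at hy; exact (hz (hy ▸ hbS)).elim
    · rwa [hφn y hyS] at hy
  set N' : α → Finset β := fun x ↦ (N x).image φ with hN'
  have hN'T : ∀ T : Finset α, T.biUnion N' = (T.biUnion N).image φ := fun T ↦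
    biUnion_image.symm
  have hN'sub : ∀ T : Finset α,
      T.biUnion N' ⊆ insert b ((S ∪ T).biUnion N \ S.biUnion N) := by
    intro T y hy
    rw [hN'T] at hy
    obtain ⟨z, hz, rfl⟩ := mem_image.1 hy
    by_cases hzS : z ∈ S.biUnion N
    · rw [hφS z hzS]; exact mem_insert_self _ _
    · rw [hφn z hzS]
      refine mem_insert_of_mem (mem_sdiff.2 ⟨?_, hzS⟩)
      rw [union_biUnion]; exact mem_union_right _ hz
  have hN'sup : ∀ T : Finset α,
      (S ∪ T).biUnion N \ S.biUnion N ⊆ T.biUnion N' := by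
    intro T y hy
    obtain ⟨hy, hyS⟩ := mem_sdiff.1 hy
    rw [union_biUnion] at hy
    rw [hN'T, ← hφn y hyS]
    exact mem_image_of_mem _ ((mem_union.1 hy).resolve_left hyS)
  have hcardST : ∀ T : Finset α,
      #((S ∪ T).biUnion N \ S.biUnion N) + (#S + 1) = #((S ∪ T).biUnion N) := fun T ↦ by
    rw [← hSc]
    exact card_sdiff_add_card_eq_card
      (biUnion_subset_biUnion_of_subset_left _ subset_union_left)
  have hexp : Expanding (A \ S) (insert b (B \ S.biUnion N)) N' := by
    refine ⟨hR, ?_, ?_, ?_⟩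
    · rw [card_insert_of_notMem fun h' ↦ (mem_sdiff.1 h').2 hbS]
      omega
    · intro x hx y hy
      obtain ⟨z, hz, rfl⟩ := mem_image.1 hy
      by_cases hzS : z ∈ S.biUnion N
      · rw [hφS z hzS]; exact mem_insert_self _ _
      · rw [hφn z hzS]
        exact mem_insert_of_mem (mem_sdiff.2 ⟨h.subset x (mem_sdiff.1 hx).1 hz, hzS⟩)
    · intro T hT hT0 hTA
      have hTA' : T ⊆ A := hT.trans sdiff_subset
      have hdisj : Disjoint S T := disjoint_sdiff.mono_right hT
      have hu : S ∪ T ≠ A := fun h' ↦ hTA (by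
        rw [← h', union_sdiff_cancel_left hdisj])
      by_cases hm : (T.biUnion N ∩ S.biUnion N).Nonempty
      · obtain ⟨y, hy⟩ := hm
        obtain ⟨hyT, hyS⟩ := mem_inter.1 hy
        have hbm : b ∈ T.biUnion N' := by
          rw [hN'T, ← hφS y hyS]; exact mem_image_of_mem _ hyT
        have h1 := h.lt_card (S ∪ T) (union_subset hS.subset hTA')
          (hT0.mono subset_union_right) hu
        have h2 := card_le_card (insert_subset hbm (hN'sup T))
        rw [card_insert_of_notMem fun h' ↦ (mem_sdiff.1 h').2 hbS] at h2
        have h3 := hcardST T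
        rw [card_union_of_disjoint hdisj] at h1
        omega
      · have h1 := h.lt_card T hTA' hT0 fun h' ↦ by
          have := hT (h' ▸ haA)
          exact (mem_sdiff.1 this).2 hS.mem
        rw [hN'T, card_image_of_injOn]
        · exact h1
        · intro y hy z hz hyz
          have h' : ∀ w ∈ T.biUnion N, w ∉ S.biUnion N := fun w hw hwS ↦
            hm ⟨w, mem_inter.2 ⟨hw, hwS⟩⟩
          rwa [hφn y (h' y hy), hφn z (h' z hz)] at hyz
  -- Were `a ∈ T`, the tight set `S ∩ T` would certify `ab`; minimality of `S` gives `S ⊆ T`, and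
  -- then `S ∪ T = A` forces `T = A`.
  have hleave : ∀ r ∈ A \ S, ∀ y ∈ N r, y ∈ S.biUnion N → ∀ T, Certifies A N r y T → a ∉ T := by
    intro r hr y hy hyS T hT haT
    have hrS := (mem_sdiff.1 hr).2
    obtain ⟨hu, ht⟩ := hT.of_leaving h.toExpanding hy hS.toTight hrS hyS
      ⟨a, mem_inter.2 ⟨hS.mem, haT⟩⟩
    have := hSmin (S ∩ T) ⟨ht, mem_inter.2 ⟨hS.mem, haT⟩,
      fun x hx ↦ hS.eq_of_mem x (mem_inter.1 hx).1⟩ inter_subset_left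
    rw [inter_eq_left] at this
    rw [union_eq_right.2 this] at hu
    exact hT.ne hu
  -- At degree at least three, the certificates of two edges from `r` into `S.biUnion N` would cover
  -- `A`, so one would contain `a`. At degree two, adding `r` to `S` would create no new neighbour.
  -- Hence the collapse preserves degrees.
  have hinj : ∀ r ∈ A \ S, ∀ y ∈ N r, ∀ z ∈ N r, y ∈ S.biUnion N → z ∈ S.biUnion N → y = z := by
    intro r hr y hy z hz hyS hzS
    obtain ⟨hrA, hrS⟩ := mem_sdiff.1 hr
    by_contra hyz
    by_cases hr3 : 3 ≤ #(N r)
    · obtain ⟨T, hT⟩ := h.exists_certifies r hrA y hy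
      obtain ⟨T', hT'⟩ := h.exists_certifies r hrA z hz
      have hu := hT.union_eq h.toExpanding hr3 hy hz hyz hT'
      rw [← hu] at haA
      exact (mem_union.1 haA).elim (hleave r hr y hy hyS T hT) (hleave r hr z hz hzS T' hT')
    · have hNr : N r = {y, z} := by
        symm
        refine eq_of_subset_of_card_le (by simp [insert_subset_iff, hy, hz]) ?_
        rw [card_pair hyz]; omega
      have hsub : N r ⊆ S.biUnion N := by
        rw [hNr]; simp only [insert_subset_iff, singleton_subset_iff]; exact ⟨hyS, hzS⟩
      have h1 : (insert r S).biUnion N = S.biUnion N := by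
        rw [biUnion_insert, union_eq_right.2 hsub]
      have h2 := h.lt_card (insert r S) (insert_subset hrA hS.subset) (insert_nonempty _ _)
        (fun h' ↦ by
          have := congrArg card h'
          rw [card_insert_of_notMem hrS] at this
          omega)
      rw [h1, card_insert_of_notMem hrS] at h2
      omega
  have hcard : ∀ r ∈ A \ S, #(N' r) = #(N r) := by
    intro r hr
    refine card_image_of_injOn fun y hy z hz hyz ↦ ?_
    by_cases hzS : z ∈ S.biUnion N
    · rw [hφS z hzS] at hyz
      exact hinj r hr y hy z hz (hφb y hyz) hzS
    · exact hφu y z hzS (hyz.trans (hφn z hzS))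
  have hmin : MinimalExpanding (A \ S) (insert b (B \ S.biUnion N)) N' := by
    refine ⟨hexp, fun r hr y' hy' ↦ ?_⟩
    obtain ⟨hrA, hrS⟩ := mem_sdiff.1 hr
    obtain ⟨y, hy, rfl⟩ := mem_image.1 hy'
    have hr2 := h.two_le_card hrA
    by_cases hr3 : 3 ≤ #(N r)
    swap
    · refine ⟨{r}, ⟨⟨by simpa using hr, fun h' ↦ ?_, ?_⟩, mem_singleton_self r, by simp⟩⟩
      · rw [← h'] at hR; simp at hR
      · rw [singleton_biUnion, hcard r hr, card_singleton]; omega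
    obtain ⟨T, hT⟩ := h.exists_certifies r hrA y hy
    by_cases hi : (S ∩ T).Nonempty
    · by_cases hyS : y ∈ S.biUnion N
      -- If `y = b`, a third neighbour of `b` fits in neither certificate. If `y ≠ b`, the common
      -- neighbourhood has excess two over `S ∩ T` but contains both `b` and `y`, neither seen from
      -- `S ∩ T`, contradicting tightness.
      · exfalso
        obtain ⟨hu, ht⟩ := hT.of_leaving h.toExpanding hy hS.toTight hrS hyS hi
        have haT := hleave r hr y hy hyS T hT
        by_cases hyb : y = b
        · subst hyb
          obtain ⟨x, hx, hyx, hxa, hxr⟩ := hdeg r hrA hr3 hy fun h' ↦ hrS (h' ▸ hS.mem)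
          rw [← hu] at hx
          exact (mem_union.1 hx).elim (fun h' ↦ hxa (hS.eq_of_mem x h' hyx))
            fun h' ↦ hxr (hT.eq_of_mem x h' hyx)
        · obtain ⟨x, hx, hxa, hbx⟩ := h.exists_ne hbB haA
          rw [← hu] at hx
          have hxT : x ∈ T := (mem_union.1 hx).resolve_left fun h' ↦ hxa (hS.eq_of_mem x h' hbx)
          have hsub : (S ∩ T).biUnion N ⊆ ((S.biUnion N ∩ T.biUnion N).erase b).erase y := by
            intro w hw
            refine mem_erase.2 ⟨?_, mem_erase.2 ⟨?_, biUnion_inter_subset S T hw⟩⟩ <;>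
              rintro rfl <;> obtain ⟨v, hv, hwv⟩ := mem_biUnion.1 hw <;>
              obtain ⟨hvS, hvT⟩ := mem_inter.1 hv
            · exact hrS (hT.eq_of_mem v hvT hwv ▸ hvS)
            · exact haT (hS.eq_of_mem v hvS hwv ▸ hvT)
          have h1 := card_le_card hsub
          have hbm : b ∈ S.biUnion N ∩ T.biUnion N :=
            mem_inter.2 ⟨hbS, mem_biUnion.2 ⟨x, hxT, hbx⟩⟩
          have hym : y ∈ (S.biUnion N ∩ T.biUnion N).erase b :=
            mem_erase.2 ⟨hyb, mem_inter.2 ⟨hyS, mem_biUnion.2 ⟨r, hT.mem, hy⟩⟩⟩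
          rw [card_erase_of_mem hym, card_erase_of_mem hbm, ht.card_eq] at h1
          have h3 := card_biUnion_union_add (N := N) S T
          have h5 := card_union_add_card_inter S T
          have h7 := hT.card_eq
          rw [hu, h.biUnion_eq, ← h.card_eq] at h3
          rw [hu] at h5
          omega
      -- Now every neighbour of `y` avoids `S`, so a second neighbour of `y` lies outside `S ∪ T`.
      -- Uncrossing makes `S ∪ T` tight, and `T \ S` is the certificate after contraction.
      · have hu : S ∪ T ≠ A := by
          intro hu
          obtain ⟨x, hx, hxr, hyx⟩ := h.exists_ne (h.subset r hrA hy) hrA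
          rw [← hu] at hx
          have hxS := (mem_union.1 hx).resolve_right fun h' ↦ hxr (hT.eq_of_mem x h' hyx)
          exact hyS (mem_biUnion.2 ⟨x, hxS, hyx⟩)
        obtain ⟨-, ht, -⟩ := hS.toTight.uncross h.toExpanding hT.toTight hi hu
        have hsub : T \ S ⊆ A \ S := sdiff_subset_sdiff hT.subset subset_rfl
        have hne : T \ S ≠ A \ S := fun h' ↦ hu (by
          rw [← union_sdiff_self_eq_union, h', union_sdiff_of_subset hS.subset])
        have hrm : r ∈ T \ S := mem_sdiff.2 ⟨hT.mem, hrS⟩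
        refine ⟨T \ S, ⟨⟨hsub, hne, ?_⟩, hrm, fun x hx hyx ↦ ?_⟩⟩
        · have h1 := hexp.lt_card _ hsub ⟨r, hrm⟩ hne
          have h2 := (card_le_card (hN'sub (T \ S))).trans (card_insert_le _ _)
          have h3 := hcardST (T \ S)
          rw [union_sdiff_self_eq_union] at h2 h3
          have h4 := ht.card_eq
          have h5 := card_union_of_disjoint (disjoint_sdiff (s := S) (t := T))
          rw [union_sdiff_self_eq_union] at h5
          omega
        · obtain ⟨z, hz, hzy⟩ := mem_image.1 hyx
          rw [hφn y hyS] at hzy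
          rw [hφu z y hyS hzy] at hz
          exact hT.eq_of_mem x (mem_sdiff.1 hx).1 hz
    · have hsub : T ⊆ A \ S := fun x hx ↦ mem_sdiff.2 ⟨hT.subset hx, fun hxS ↦
        hi ⟨x, mem_inter.2 ⟨hxS, hx⟩⟩⟩
      -- Here the assumption that `A \ S` has excess other than one is needed: `T` stays proper, and
      -- expansion then forces `φ` to be injective on its neighbourhood.
      have hne : T ≠ A \ S := fun h' ↦ hRt (h' ▸ hT.card_eq)
      have h1 := hexp.lt_card _ hsub ⟨r, hT.mem⟩ hne
      rw [hN'T] at h1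
      have h2 := card_image_le (s := T.biUnion N) (f := φ)
      have h3 := hT.card_eq
      have hinjT : Set.InjOn φ (T.biUnion N) := card_image_iff.1 (by omega)
      refine ⟨T, ⟨⟨hsub, hne, by rw [hN'T]; omega⟩, hT.mem, fun x hx hyx ↦ ?_⟩⟩
      obtain ⟨z, hz, hzy⟩ := mem_image.1 hyx
      have : z = y := hinjT (mem_coe.2 (mem_biUnion.2 ⟨x, hx, hz⟩))
        (mem_coe.2 (mem_biUnion.2 ⟨r, hT.mem, hy⟩)) hzy
      subst this
      exact hT.eq_of_mem x hx hz
  have h1 := ih _ _ _ (by have := card_pos.2 ⟨a, hS.mem⟩; omega) hmin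
  rwa [sum_congr rfl fun r hr ↦ by rw [hcard r hr]] at h1

/-- A minimal expanding relation has many members of `A` of degree two. -/
theorem MinimalExpanding.sum_weight_le (h : MinimalExpanding A B N) :
    ∑ a ∈ A, weight #(N a) ≤ -2 := by
  induction hk : #A using Nat.strong_induction_on generalizing A B N with
  | _ k ih =>
  subst hk
  replace ih : ∀ (A' : Finset α) (B' : Finset β) (N' : α → Finset β), #A' < #A →
      MinimalExpanding A' B' N' → ∑ a ∈ A', weight #(N' a) ≤ -2 :=
    fun A' B' N' hlt hm ↦ ih #A' hlt hm rfl
  have htwo : ∀ a ∈ A, ¬ 3 ≤ #(N a) → weight #(N a) = -1 := fun a ha ha3 ↦ by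
    have := h.two_le_card ha
    rw [show #(N a) = 2 by omega, weight_two]
  by_cases hA3 : ∃ a ∈ A, 3 ≤ #(N a)
  swap
  · push Not at hA3
    rw [sum_congr rfl fun a ha ↦ htwo a ha (by have := hA3 a ha; omega)]
    have := h.two_le
    simp only [sum_const, smul_neg, nsmul_eq_mul, mul_one]
    omega
  obtain ⟨a, haA, ha⟩ := hA3
  by_cases hbi : ∃ b ∈ N a, ∃ r ∈ A, r ≠ a ∧ 3 ≤ #(N r) ∧ b ∈ N r ∧
      ∀ x ∈ A, b ∈ N x → x = a ∨ x = r
  · obtain ⟨b, hba, r, hrA, hra, hr, hbr, hb⟩ := hbi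
    exact sum_weight_le_of_bicontraction h haA hrA hra.symm ha hr hba hbr hb ih
  have hdeg : ∀ b ∈ N a, ∀ r ∈ A, 3 ≤ #(N r) → b ∈ N r → r ≠ a →
      ∃ x ∈ A, b ∈ N x ∧ x ≠ a ∧ x ≠ r := by
    intro b hb r hr hr3 hbr hra
    by_contra! hno
    exact hbi ⟨b, hb, r, hr, hra, hr3, hbr, fun x hx hbx ↦ by
      by_contra! hn
      exact hn.2 (hno x hx hbx hn.1)⟩
  have hminc : ∀ b ∈ N a, ∃ S, Certifies A N a b S ∧
      ∀ T, Certifies A N a b T → T ⊆ S → T = S := by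
    intro b hb
    obtain ⟨S₀, hS₀⟩ := h.exists_certifies a haA b hb
    obtain ⟨S, -, hS⟩ := exists_minimal_le_of_wellFoundedLT (Certifies A N a b) S₀ hS₀
    exact ⟨S, hS.prop, fun T hT hTS ↦ hS.eq_of_le hT hTS⟩
  choose! S hS hSmin using hminc
  by_cases hbig : ∃ b ∈ N a, 2 ≤ #(A \ S b)
  · obtain ⟨b, hb, hR⟩ := hbig
    have hcards : #(A \ S b) + #(S b) = #A := card_sdiff_add_card_eq_card (hS b hb).subset
    have h1 := sum_weight_tight_le h (hS b hb).toTight ⟨a, (hS b hb).mem⟩ (by omega) ih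
    -- If `A \ S b` has excess one it is itself tight, and its own complement can be contracted;
    -- otherwise `S b` is contracted with its neighbourhood.
    have h2 : ∑ x ∈ A \ S b, weight #(N x) ≤ -1 := by
      by_cases hRt : #((A \ S b).biUnion N) = #(A \ S b) + 1
      · refine sum_weight_tight_le h ⟨sdiff_subset, fun h' ↦ ?_, hRt⟩
          (card_pos.1 (by omega)) ?_ ih
        · have := h'.symm ▸ haA
          exact (mem_sdiff.1 this).2 (hS b hb).mem
        · have h0 : S b ≠ {a} := fun h' ↦ by
            have := (hS b hb).card_eq
            rw [h', singleton_biUnion, card_singleton] at this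
            omega
          have := one_lt_card_iff_nontrivial.2 ((nontrivial_iff_ne_singleton (hS b hb).mem).2 h0)
          omega
      · have := sum_weight_sdiff_le h haA hb (hS b hb) (hSmin b hb) (hdeg b hb) hR hRt ih
        omega
    rw [← sum_sdiff (hS b hb).subset]
    omega
  push Not at hbig
  -- Every certificate now omits a single vertex `r b`. Thus `b` has only the neighbours `a` and `r
  -- b`, and `r b` has degree two since no bicontraction is available.
  have hsing : ∀ b ∈ N a, ∃ r, A \ S b = {r} := fun b hb ↦ by
    rw [← card_eq_one]
    have := card_pos.2 (hS b hb).nonempty_sdiff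
    have := hbig b hb
    omega
  have : Nonempty α := ⟨a⟩
  choose! r hr using hsing
  have hrm : ∀ b ∈ N a, r b ∈ A ∧ r b ∉ S b := fun b hb ↦ by
    rw [← mem_sdiff, hr b hb]; exact mem_singleton_self _
  have hmemS : ∀ b ∈ N a, ∀ x ∈ A, x ≠ r b → x ∈ S b := by
    intro b hb x hx hxr
    by_contra hxS
    have := mem_sdiff.2 ⟨hx, hxS⟩
    rw [hr b hb, mem_singleton] at this
    exact hxr this
  have hbr : ∀ b ∈ N a, ∀ x ∈ A, b ∈ N x → x = a ∨ x = r b := by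
    intro b hb x hx hbx
    by_cases hxr : x = r b
    · exact .inr hxr
    · exact .inl ((hS b hb).eq_of_mem x (hmemS b hb x hx hxr) hbx)
  have hra : ∀ b ∈ N a, r b ≠ a := fun b hb h' ↦ (hrm b hb).2 (h' ▸ (hS b hb).mem)
  have hrb : ∀ b ∈ N a, b ∈ N (r b) := by
    intro b hb
    obtain ⟨x, hx, hxa, hbx⟩ := h.exists_ne (h.subset a haA hb) haA
    exact (hbr b hb x hx hbx).resolve_left hxa ▸ hbx
  have hr2 : ∀ b ∈ N a, weight #(N (r b)) = -1 := by
    intro b hb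
    refine htwo _ (hrm b hb).1 fun h3 ↦ ?_
    obtain ⟨x, hx, hbx, hxa, hxr⟩ := hdeg b hb (r b) (hrm b hb).1 h3 (hrb b hb) (hra b hb)
    exact (hbr b hb x hx hbx).elim hxa hxr
  have hinj : Set.InjOn r (N a) := by
    intro b hb b' hb' hbb
    by_contra hne
    have hu := (hS b hb).union_eq h.toExpanding ha hb hb' hne (hS b' hb')
    have := (hrm b hb).1
    rw [← hu] at this
    exact (mem_union.1 this).elim (hrm b hb).2 (by rw [hbb]; exact (hrm b' hb').2)
  -- The `r b` are distinct because two certificates at `a` cover `A`. So `Q` has weight `(d - 2) -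
  -- d = -2`, where `d = #(N a)`.
  set Q := insert a ((N a).image r) with hQ
  have haQ : a ∉ (N a).image r := by
    intro h'
    obtain ⟨b, hb, hb'⟩ := mem_image.1 h'
    exact hra b hb hb'
  have hQA : Q ⊆ A := by
    refine insert_subset haA fun x hx ↦ ?_
    obtain ⟨b, hb, rfl⟩ := mem_image.1 hx
    exact (hrm b hb).1
  have hQc : #Q = #(N a) + 1 := by rw [card_insert_of_notMem haQ, card_image_of_injOn hinj]
  have hQs : ∑ x ∈ Q, weight #(N x) = -2 := by
    rw [sum_insert haQ, sum_image hinj, sum_congr rfl hr2, weight_of_three_le ha]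
    simp only [sum_const, smul_neg, nsmul_eq_mul, mul_one]
    ring
  have hcards := card_sdiff_add_card_eq_card hQA
  have hZ : ∑ x ∈ A \ Q, weight #(N x) ≤ 0 := by
    rcases (A \ Q).eq_empty_or_nonempty with h0 | h0
    · rw [h0]; simp
    have hne : A \ Q ≠ A := fun h' ↦ by
      have := h'.symm ▸ haA
      exact (mem_sdiff.1 this).2 (mem_insert_self _ _)
    have h1 := h.lt_card _ sdiff_subset h0 hne
    -- All neighbours of members of `N a` lie in `Q`, so `A \ Q` has excess at most one: it is empty
    -- or tight.
    have h2 : (A \ Q).biUnion N ⊆ B \ N a := by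
      intro y hy
      obtain ⟨x, hx, hyx⟩ := mem_biUnion.1 hy
      obtain ⟨hxA, hxQ⟩ := mem_sdiff.1 hx
      refine mem_sdiff.2 ⟨h.subset x hxA hyx, fun hya ↦ hxQ ?_⟩
      rcases hbr y hya x hxA hyx with rfl | rfl
      · exact mem_insert_self _ _
      · exact mem_insert_of_mem (mem_image_of_mem _ hya)
    have h3 := card_le_card h2
    have h4 := card_sdiff_add_card_eq_card (h.subset a haA)
    have h5 := h.card_eq
    have := sum_weight_tight_le h ⟨sdiff_subset, hne, by omega⟩ h0 (by omega) ih
    omega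
  rw [← sum_sdiff hQA]
  omega

/-! ### Gluing two relations along two crossing edges -/

/-- The expansion property, relative to `a ∈ A` and `b ∈ B`, that makes the relation expanding once
an ear of length three joining `a` and `b` is added. -/
structure EarExpanding (A : Finset α) (B : Finset β) (N : α → Finset β) (a : α) (b : β) :
    Prop where
  card_eq : #A = #B
  le_add : ∀ T ⊆ A, T.Nonempty → #T + 1 ≤ #(T.biUnion N) + if a ∈ T then 1 else 0
  le_insert : ∀ T ⊆ A, T ≠ A → #T + 1 ≤ #(insert b (T.biUnion N))

/-- A relation joined from two relations by two crossing edges is expanding if and only if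
both parts are. -/
lemma expanding_iff_earExpanding {A₁ A₂ : Finset α} {B₁ B₂ : Finset β} {N₁ N₂ : α → Finset β}
    {a₁ a₂ : α} {b₁ b₂ : β} (hA : A₁ ∪ A₂ = A) (hB : B₁ ∪ B₂ = B) (hAd : Disjoint A₁ A₂)
    (hBd : Disjoint B₁ B₂) (ha₁ : a₁ ∈ A₁) (ha₂ : a₂ ∈ A₂) (hb₁ : b₁ ∈ B₁) (hb₂ : b₂ ∈ B₂)
    (hN₁B : ∀ x ∈ A₁, N₁ x ⊆ B₁) (hN₂B : ∀ x ∈ A₂, N₂ x ⊆ B₂)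
    (hN₁ : ∀ x ∈ A₁, N x = N₁ x ∪ if x = a₁ then {b₂} else ∅)
    (hN₂ : ∀ x ∈ A₂, N x = N₂ x ∪ if x = a₂ then {b₁} else ∅) :
    Expanding A B N ↔ EarExpanding A₁ B₁ N₁ a₁ b₁ ∧ EarExpanding A₂ B₂ N₂ a₂ b₂ := by
  have hbi₁ : ∀ T ⊆ A₁, T.biUnion N = T.biUnion N₁ ∪ if a₁ ∈ T then {b₂} else ∅ := by
    intro T hT
    ext y
    simp only [mem_biUnion, mem_union]
    constructor
    · rintro ⟨x, hx, hy⟩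
      rw [hN₁ x (hT hx), mem_union] at hy
      rcases hy with hy | hy
      · exact .inl ⟨x, hx, hy⟩
      · split_ifs at hy with hxa
        · subst hxa; rw [if_pos hx]; exact .inr hy
        · simp at hy
    · rintro (⟨x, hx, hy⟩ | hy)
      · exact ⟨x, hx, by rw [hN₁ x (hT hx)]; exact mem_union_left _ hy⟩
      · split_ifs at hy with hxa
        · exact ⟨a₁, hxa, by rw [hN₁ _ ha₁, if_pos rfl]; exact mem_union_right _ hy⟩
        · simp at hy
  have hbi₂ : ∀ T ⊆ A₂, T.biUnion N = T.biUnion N₂ ∪ if a₂ ∈ T then {b₁} else ∅ := by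
    intro T hT
    ext y
    simp only [mem_biUnion, mem_union]
    constructor
    · rintro ⟨x, hx, hy⟩
      rw [hN₂ x (hT hx), mem_union] at hy
      rcases hy with hy | hy
      · exact .inl ⟨x, hx, hy⟩
      · split_ifs at hy with hxa
        · subst hxa; rw [if_pos hx]; exact .inr hy
        · simp at hy
    · rintro (⟨x, hx, hy⟩ | hy)
      · exact ⟨x, hx, by rw [hN₂ x (hT hx)]; exact mem_union_left _ hy⟩
      · split_ifs at hy with hxa
        · exact ⟨a₂, hxa, by rw [hN₂ _ ha₂, if_pos rfl]; exact mem_union_right _ hy⟩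
        · simp at hy
  have hsub₁ : ∀ T ⊆ A₁, T.biUnion N₁ ⊆ B₁ := fun T hT ↦
    biUnion_subset.2 fun x hx ↦ hN₁B x (hT hx)
  have hsub₂ : ∀ T ⊆ A₂, T.biUnion N₂ ⊆ B₂ := fun T hT ↦
    biUnion_subset.2 fun x hx ↦ hN₂B x (hT hx)
  -- Each side contributes its own neighbourhood, plus its end of the crossing edge that starts in
  -- the other part of the set.
  have hcard : ∀ T₁ ⊆ A₁, ∀ T₂ ⊆ A₂, #((T₁ ∪ T₂).biUnion N) =
      #(if a₂ ∈ T₂ then insert b₁ (T₁.biUnion N₁) else T₁.biUnion N₁) +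
      #(if a₁ ∈ T₁ then insert b₂ (T₂.biUnion N₂) else T₂.biUnion N₂) := by
    intro T₁ hT₁ T₂ hT₂
    rw [← card_union_of_disjoint, union_biUnion, hbi₁ T₁ hT₁, hbi₂ T₂ hT₂]
    · congr 1
      split_ifs <;> (ext y; simp only [mem_union, mem_insert, mem_singleton, notMem_empty]; tauto)
    · refine hBd.mono ?_ ?_
      · split_ifs
        · exact insert_subset hb₁ (hsub₁ T₁ hT₁)
        · exact hsub₁ T₁ hT₁
      · split_ifs
        · exact insert_subset hb₂ (hsub₂ T₂ hT₂)
        · exact hsub₂ T₂ hT₂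
  have hcA := card_union_of_disjoint hAd
  have hcB := card_union_of_disjoint hBd
  rw [hA] at hcA
  rw [hB] at hcB
  have hna₁ : a₁ ∉ A₂ := fun h ↦ disjoint_left.1 hAd ha₁ h
  have hna₂ : a₂ ∉ A₁ := fun h ↦ disjoint_left.1 hAd h ha₂
  have hA₁A : A₁ ⊆ A := hA ▸ subset_union_left
  have hA₂A : A₂ ⊆ A := hA ▸ subset_union_right
  constructor
  · intro h
    have hone₁ : ∀ T ⊆ A₁, T.Nonempty →
        #T + 1 ≤ #(T.biUnion N₁) + if a₁ ∈ T then 1 else 0 := by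
      intro T hT hT0
      have h1 := h.lt_card T (hT.trans hA₁A) hT0 fun h' ↦ hna₂ (hT (h' ▸ hA₂A ha₂))
      have h2 := hcard T hT ∅ (empty_subset _)
      rw [union_empty] at h2
      split_ifs at h2 ⊢ <;> simp_all
    have hone₂ : ∀ T ⊆ A₂, T.Nonempty →
        #T + 1 ≤ #(T.biUnion N₂) + if a₂ ∈ T then 1 else 0 := by
      intro T hT hT0
      have h1 := h.lt_card T (hT.trans hA₂A) hT0 fun h' ↦ hna₁ (hT (h' ▸ hA₁A ha₁))
      have h2 := hcard ∅ (empty_subset _) T hT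
      rw [empty_union] at h2
      split_ifs at h2 ⊢ <;> simp_all <;> omega
    -- The full classes give `#A₁ ≤ #B₁` and `#A₂ ≤ #B₂`; as `#A = #B`, both are equalities.
    have h1 := hone₁ A₁ subset_rfl ⟨a₁, ha₁⟩
    have h2 := hone₂ A₂ subset_rfl ⟨a₂, ha₂⟩
    rw [if_pos ha₁] at h1
    rw [if_pos ha₂] at h2
    have h3 := card_le_card (hsub₁ A₁ subset_rfl)
    have h4 := card_le_card (hsub₂ A₂ subset_rfl)
    have h5 := h.card_eq
    refine ⟨⟨by omega, hone₁, fun T hT hTA ↦ ?_⟩, ⟨by omega, hone₂, fun T hT hTA ↦ ?_⟩⟩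
    -- Testing `T ∪ A₂` switches on the gain of `b₁`, while the second side contributes at most `#B₂
    -- = #A₂`.
    · have h6 := hcard T hT A₂ subset_rfl
      rw [if_pos ha₂] at h6
      have h7 : #(if a₁ ∈ T then insert b₂ (A₂.biUnion N₂) else A₂.biUnion N₂) ≤ #B₂ := by
        refine card_le_card ?_
        split_ifs
        · exact insert_subset hb₂ (hsub₂ _ subset_rfl)
        · exact hsub₂ _ subset_rfl
      have hd : Disjoint T A₂ := hAd.mono_left hT
      have h8 := h.lt_card (T ∪ A₂) (union_subset (hT.trans hA₁A) hA₂A)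
        ⟨a₂, mem_union_right _ ha₂⟩ fun h' ↦ hTA (by
          refine hT.antisymm fun x hx ↦ ?_
          have := hA₁A hx
          rw [← h'] at this
          exact (mem_union.1 this).resolve_right (disjoint_left.1 hAd hx))
      rw [card_union_of_disjoint hd] at h8
      omega
    · have h6 := hcard A₁ subset_rfl T hT
      rw [if_pos ha₁] at h6
      have h7 : #(if a₂ ∈ T then insert b₁ (A₁.biUnion N₁) else A₁.biUnion N₁) ≤ #B₁ := by
        refine card_le_card ?_
        split_ifs
        · exact insert_subset hb₁ (hsub₁ _ subset_rfl)
        · exact hsub₁ _ subset_rfl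
      have hd : Disjoint A₁ T := hAd.mono_right hT
      have h8 := h.lt_card (A₁ ∪ T) (union_subset hA₁A (hT.trans hA₂A))
        ⟨a₁, mem_union_left _ ha₁⟩ fun h' ↦ hTA (by
          refine hT.antisymm fun x hx ↦ ?_
          have := hA₂A hx
          rw [← h'] at this
          exact (mem_union.1 this).resolve_left (disjoint_right.1 hAd hx))
      rw [card_union_of_disjoint hd] at h8
      omega
  · rintro ⟨h₁, h₂⟩
    refine ⟨?_, by rw [hcA, hcB, h₁.card_eq, h₂.card_eq], ?_, ?_⟩
    · have := card_pos.2 ⟨a₁, ha₁⟩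
      have := card_pos.2 ⟨a₂, ha₂⟩
      omega
    · intro x hx
      rw [← hA, mem_union] at hx
      rw [← hB]
      rcases hx with hx | hx
      · rw [hN₁ x hx]
        refine union_subset ((hN₁B x hx).trans subset_union_left) ?_
        split_ifs
        · exact singleton_subset_iff.2 (mem_union_right _ hb₂)
        · exact empty_subset _
      · rw [hN₂ x hx]
        refine union_subset ((hN₂B x hx).trans subset_union_right) ?_
        split_ifs
        · exact singleton_subset_iff.2 (mem_union_left _ hb₁)
        · exact empty_subset _
    · intro T hT hT0 hTA
      have hTe : (T ∩ A₁) ∪ (T ∩ A₂) = T := by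
        rw [← inter_union_distrib_left, hA, inter_eq_left.2 hT]
      generalize hT₁ : T ∩ A₁ = T₁ at hTe
      generalize hT₂ : T ∩ A₂ = T₂ at hTe
      have hs₁ : T₁ ⊆ A₁ := hT₁ ▸ inter_subset_right
      have hs₂ : T₂ ⊆ A₂ := hT₂ ▸ inter_subset_right
      have hc := hcard T₁ hs₁ T₂ hs₂
      have hcT := card_union_of_disjoint (hAd.mono hs₁ hs₂)
      rw [hTe] at hc hcT
      rw [hc, hcT]
      have e₁ := h₁.le_add T₁ hs₁
      have e₂ := h₂.le_add T₂ hs₂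
      have i₁ := h₁.le_insert T₁ hs₁
      have i₂ := h₂.le_insert T₂ hs₂
      have l₁ := card_le_card (subset_insert b₁ (T₁.biUnion N₁))
      have l₂ := card_le_card (subset_insert b₂ (T₂.biUnion N₂))
      -- With both `a₁` and `a₂` present, the extra unit comes from a side that is not full. With
      -- exactly one, it comes from the other side, enlarged by its `bᵢ`. With neither, it comes
      -- from any nonempty side.
      by_cases m₁ : a₁ ∈ T₁ <;> by_cases m₂ : a₂ ∈ T₂
      · have e₁ := e₁ ⟨a₁, m₁⟩
        have e₂ := e₂ ⟨a₂, m₂⟩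
        simp only [m₁, m₂, if_true] at e₁ e₂ ⊢
        by_cases hf : T₁ = A₁
        · have := i₂ fun hf₂ ↦ hTA (by rw [← hTe, hf, hf₂, hA])
          omega
        · have := i₁ hf
          omega
      · have e₁ := e₁ ⟨a₁, m₁⟩
        have i₂ := i₂ fun h' ↦ m₂ (h' ▸ ha₂)
        simp only [m₁, m₂, if_true, if_false] at e₁ ⊢
        omega
      · have e₂ := e₂ ⟨a₂, m₂⟩
        have i₁ := i₁ fun h' ↦ m₁ (h' ▸ ha₁)
        simp only [m₁, m₂, if_true, if_false] at e₂ ⊢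
        omega
      · simp only [m₁, m₂, if_false] at e₁ e₂ ⊢
        rcases T₁.eq_empty_or_nonempty with rfl | n₁ <;>
          rcases T₂.eq_empty_or_nonempty with rfl | n₂
        · rw [← hTe] at hT0; simp at hT0
        · have := e₂ n₂; simp; omega
        · have := e₁ n₁; simp; omega
        · have := e₁ n₁; have := e₂ n₂; omega

end BipartiteExpansion

/-! ### Hall criterion and the degree-two bound for graphs -/

namespace Graph

set_option linter.unusedSectionVars false

open BipartiteExpansion
open scoped Finset

variable {α β : Type*} {G : Graph α β}

lemma IsBipartition.symm {A B : Set α} (h : G.IsBipartition A B) : G.IsBipartition B A :=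
  ⟨h.disjoint.symm, by rw [Set.union_comm, h.union_eq], fun _ _ _ he ↦ (h.of_isLink he).symm⟩

lemma IsBipartition.right_mem {A B : Set α} (h : G.IsBipartition A B) {e : β} {x y : α}
    (he : G.IsLink e x y) (hx : x ∈ A) : y ∈ B := by
  rcases h.of_isLink he with h' | h'
  · exact h'.2
  · exact (h.disjoint.le_bot ⟨hx, h'.1⟩).elim

lemma IsBipartition.left_mem {A B : Set α} (h : G.IsBipartition A B) {e : β} {x y : α}
    (he : G.IsLink e x y) (hy : y ∈ B) : x ∈ A :=
  h.symm.right_mem he.symm hy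

lemma IsBipartition.deleteEdges {A B : Set α} (h : G.IsBipartition A B) (F : Set β) :
    (G.deleteEdges F).IsBipartition A B :=
  ⟨h.disjoint, h.union_eq, fun _ _ _ he ↦ h.of_isLink he.1⟩

lemma IsBipartition.exists_isLink {A B : Set α} (h : G.IsBipartition A B) {e : β}
    (he : e ∈ E(G)) : ∃ x ∈ A, ∃ y ∈ B, G.IsLink e x y := by
  obtain ⟨x, y, hl⟩ := G.exists_isLink_of_mem_edgeSet he
  rcases h.of_isLink hl with h' | h'
  · exact ⟨x, h'.1, y, h'.2, hl⟩
  · exact ⟨y, h'.2, x, h'.1, hl.symm⟩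

open scoped Classical in
/-- The neighbours of `x` in the finite set `B`. -/
noncomputable def neighborsIn (G : Graph α β) (B : Finset α) (x : α) : Finset α :=
  B.filter (G.Adj x)

lemma mem_neighborsIn {B : Finset α} {x y : α} :
    y ∈ G.neighborsIn B x ↔ y ∈ B ∧ G.Adj x y := by
  simp [neighborsIn]

section criterion

variable [DecidableEq α] {A B : Finset α}

lemma IsBipartition.mem_neighborsIn (h : G.IsBipartition (A : Set α) B) {x y : α} (hx : x ∈ A) :
    y ∈ G.neighborsIn B x ↔ G.Adj x y := by
  rw [Graph.mem_neighborsIn, and_iff_right_iff_imp]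
  rintro ⟨e, he⟩
  exact h.right_mem he hx

lemma IsBipartition.mem_vertexSet (h : G.IsBipartition (A : Set α) B) {x : α} :
    x ∈ V(G) ↔ x ∈ A ∨ x ∈ B := by
  rw [← h.union_eq]; simp

lemma IsBipartition.ncard_vertexSet (h : G.IsBipartition (A : Set α) B) :
    V(G).ncard = #A + #B := by
  rw [← h.union_eq, ← Finset.coe_union, Set.ncard_coe_finset,
    Finset.card_union_of_disjoint (Finset.disjoint_coe.1 h.disjoint)]

lemma IsPerfectMatching.exists_injOn (h : G.IsBipartition (A : Set α) B) {M : Set β}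
    (hM : G.IsPerfectMatching M) : ∃ f : α → α, Set.InjOn f A ∧
      (∀ x ∈ A, f x ∈ G.neighborsIn B x) ∧ ∀ e ∈ M, ∀ x ∈ A, ∀ y, G.IsLink e x y → f x = y := by
  have hex : ∀ x ∈ A, ∃ y, ∃ e ∈ M, G.IsLink e x y := by
    intro x hx
    obtain ⟨e, ⟨he, y, hy⟩, -⟩ := hM.existsUnique x (h.mem_vertexSet.2 (.inl hx))
    exact ⟨y, e, he, hy⟩
  rcases A.eq_empty_or_nonempty with rfl | ⟨a, -⟩
  · exact ⟨id, by simp, by simp, by simp⟩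
  have : Nonempty α := ⟨a⟩
  choose! f e he hl using hex
  refine ⟨f, fun x hx y hy hxy ↦ ?_, fun x hx ↦ (h.mem_neighborsIn hx).2 (hl x hx).adj,
    fun e' he' x hx y hy ↦ ?_⟩
  · have hye := hl y hy
    rw [← hxy] at hye
    have := (hM.existsUnique (f x) (hl x hx).right_mem).unique ⟨he x hx, (hl x hx).inc_right⟩
      ⟨he y hy, hye.inc_right⟩
    exact (hl x hx).left_unique (this ▸ hye)
  · have := (hM.existsUnique x hy.left_mem).unique ⟨he x hx, (hl x hx).inc_left⟩
      ⟨he', hy.inc_left⟩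
    exact (hl x hx).right_unique (this ▸ hy)

lemma IsPerfectMatching.card_le (h : G.IsBipartition (A : Set α) B) {M : Set β}
    (hM : G.IsPerfectMatching M) : #A ≤ #B := by
  obtain ⟨f, hf, hfN, -⟩ := hM.exists_injOn h
  exact Finset.card_le_card_of_injOn f (fun x hx ↦ (Graph.mem_neighborsIn.1 (hfN x hx)).1) hf

/-- Equal class sizes make the injection `f` onto `B`, so each vertex of `B` is covered as well, and
only once. -/
lemma isPerfectMatching_image (h : G.IsBipartition (A : Set α) B) (hc : #A = #B) {f : α → α}
    {e : α → β} (hf : Set.InjOn f A) (he : ∀ x ∈ A, G.IsLink (e x) x (f x)) :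
    G.IsPerfectMatching (e '' A) := by
  have hmaps : ∀ x ∈ A, f x ∈ B := fun x hx ↦ h.right_mem (he x hx) hx
  have hsurj : ∀ y ∈ B, ∃ x ∈ A, f x = y := by
    intro y hy
    have := Finset.eq_of_subset_of_card_le (Finset.image_subset_iff.2 hmaps)
      (by rw [Finset.card_image_of_injOn hf, hc])
    rw [← this] at hy
    exact Finset.mem_image.1 hy
  have hdisj : ∀ x ∈ A, x ∉ B := fun x hx hxB ↦ h.disjoint.le_bot ⟨hx, hxB⟩
  refine ⟨?_, fun x hx ↦ ?_⟩
  · rintro _ ⟨x, hx, rfl⟩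
    exact (he x hx).edge_mem
  rcases h.mem_vertexSet.1 hx with hx | hx
  · refine ⟨e x, ⟨⟨x, hx, rfl⟩, (he x hx).inc_left⟩, ?_⟩
    rintro _ ⟨⟨x', hx', rfl⟩, hinc⟩
    rcases hinc.eq_or_eq_of_isLink (he x' hx') with rfl | rfl
    · rfl
    · exact (hdisj _ hx (hmaps x' hx')).elim
  · obtain ⟨z, hz, rfl⟩ := hsurj x hx
    refine ⟨e z, ⟨⟨z, hz, rfl⟩, (he z hz).inc_right⟩, ?_⟩
    rintro _ ⟨⟨x', hx', rfl⟩, hinc⟩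
    rcases hinc.eq_or_eq_of_isLink (he x' hx') with h' | h'
    · exact (hdisj x' hx' (h' ▸ hx)).elim
    · rw [hf hz hx' h']

/-- Connectivity provides an edge `xy` with `x ∈ A \ T` and `y` a neighbour of `T`. A perfect
matching through it sends `T` injectively to the neighbours of `T` other than `y`. -/
lemma IsMatchingCovered.expanding (h : G.IsBipartition (A : Set α) B) (hG : G.IsMatchingCovered) :
    Expanding A B (G.neighborsIn B) := by
  have hV := hG.four_le_order
  rw [h.ncard_vertexSet] at hV
  obtain ⟨e, he⟩ : E(G).Nonempty := by
    obtain ⟨x, hx⟩ := hG.connected.1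
    obtain ⟨y, hy, hyx⟩ : ∃ y ∈ V(G), y ≠ x := by
      by_contra! hno
      have : V(G) ⊆ {x} := hno
      have := Set.ncard_le_ncard this
      have := hG.four_le_order
      simp at *
      omega
    rcases (hG.connected.2 x hx y hy).cases_head with rfl | ⟨z, ⟨e, hz⟩, -⟩
    · exact (hyx rfl).elim
    · exact ⟨e, hz.edge_mem⟩
  obtain ⟨M, hM, -⟩ := hG.matchable e he
  have hc : #A = #B := (hM.card_le h).antisymm (hM.card_le h.symm)
  refine ⟨by omega, hc, fun x _ y hy ↦ (Graph.mem_neighborsIn.1 hy).1, fun T hT hT0 hTA ↦ ?_⟩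
  obtain ⟨x, hx, y, hy, e, hxy⟩ : ∃ x ∈ A \ T, ∃ y ∈ T.biUnion (G.neighborsIn B), G.Adj x y := by
    by_contra! hno
    obtain ⟨t, ht⟩ := hT0
    obtain ⟨a, haA, haT⟩ := Finset.exists_of_ssubset (hT.ssubset_of_ne hTA)
    have hreach := hG.connected.2 t (h.mem_vertexSet.2 (.inl (hT ht))) a
      (h.mem_vertexSet.2 (.inl haA))
    have hinv : a ∈ T ∪ T.biUnion (G.neighborsIn B) := by
      clear haA haT
      induction hreach with
      | refl => exact Finset.mem_union_left _ ht
      | tail _ hadj ih =>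
        rename_i b c _
        rcases Finset.mem_union.1 ih with ih | ih
        · exact Finset.mem_union_right _
            (Finset.mem_biUnion.2 ⟨_, ih, (h.mem_neighborsIn (hT ih)).2 hadj⟩)
        · obtain ⟨z, hz, hbz⟩ := Finset.mem_biUnion.1 ih
          have hbB := (Graph.mem_neighborsIn.1 hbz).1
          obtain ⟨e, he⟩ := hadj
          have hcA : c ∈ A := h.symm.right_mem he hbB
          by_contra hcT
          exact hno c (Finset.mem_sdiff.2 ⟨hcA, fun h' ↦ hcT (Finset.mem_union_left _ h')⟩) b ih
            he.symm.adj
    rcases Finset.mem_union.1 hinv with h' | h'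
    · exact haT h'
    · obtain ⟨z, hz, hbz⟩ := Finset.mem_biUnion.1 h'
      exact h.disjoint.le_bot ⟨haA, (Graph.mem_neighborsIn.1 hbz).1⟩
  obtain ⟨hxA, hxT⟩ := Finset.mem_sdiff.1 hx
  obtain ⟨M, hM, heM⟩ := hG.matchable e hxy.edge_mem
  obtain ⟨f, hf, hfN, hfM⟩ := hM.exists_injOn h
  have h1 : #T ≤ #((T.biUnion (G.neighborsIn B)).erase y) := by
    refine Finset.card_le_card_of_injOn f (fun z hz ↦ ?_) (hf.mono (by exact_mod_cast hT))
    refine Finset.mem_erase.2 ⟨fun hzy ↦ hxT ?_, Finset.mem_biUnion.2 ⟨z, hz, hfN z (hT hz)⟩⟩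
    rw [← hfM e heM x hxA y hxy] at hzy
    rwa [← hf (hT hz) hxA hzy]
  rw [Finset.card_erase_of_mem hy] at h1
  have := Finset.card_pos.2 ⟨y, hy⟩
  omega

/-- The reachable and unreachable parts of `A` have disjoint neighbourhoods. Were both nonempty, `B`
would have at least `#A + 2` members. -/
lemma isConnected_of_expanding (h : G.IsBipartition (A : Set α) B)
    (hG : Expanding A B (G.neighborsIn B)) : G.IsConnected := by
  classical
  have hA := hG.two_le
  have hB := hG.card_eq
  refine ⟨?_, fun x hx ↦ ?_⟩
  · obtain ⟨a, ha⟩ := Finset.card_pos.1 (show 0 < #A by omega)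
    exact ⟨a, h.mem_vertexSet.2 (.inl ha)⟩
  set T := A.filter (Relation.ReflTransGen G.Adj x) with hT
  have hnb : ∀ b ∈ B, ∃ a ∈ A, G.Adj a b := by
    intro b hb
    rw [← hG.biUnion_eq] at hb
    obtain ⟨a, ha, hab⟩ := Finset.mem_biUnion.1 hb
    exact ⟨a, ha, (Graph.mem_neighborsIn.1 hab).2⟩
  have hT0 : T.Nonempty := by
    rcases h.mem_vertexSet.1 hx with hx | hx
    · exact ⟨x, Finset.mem_filter.2 ⟨hx, .refl⟩⟩
    · obtain ⟨a, ha, hax⟩ := hnb x hx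
      exact ⟨a, Finset.mem_filter.2 ⟨ha, .single hax.symm⟩⟩
  have hTA : T = A := by
    by_contra hne
    have hTs : T ⊆ A := Finset.filter_subset _ _
    have h1 := hG.lt_card T hTs hT0 hne
    have h2 := hG.lt_card (A \ T) Finset.sdiff_subset
      (Finset.sdiff_nonempty.2 fun h' ↦ hne (hTs.antisymm h')) (fun h' ↦ by
        obtain ⟨t, ht⟩ := hT0
        have := h'.symm ▸ hTs ht
        exact (Finset.mem_sdiff.1 this).2 ht)
    have hd : Disjoint (T.biUnion (G.neighborsIn B)) ((A \ T).biUnion (G.neighborsIn B)) := by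
      refine Finset.disjoint_left.2 fun y hy hy' ↦ ?_
      obtain ⟨z, hz, hyz⟩ := Finset.mem_biUnion.1 hy
      obtain ⟨w, hw, hyw⟩ := Finset.mem_biUnion.1 hy'
      obtain ⟨hwA, hwT⟩ := Finset.mem_sdiff.1 hw
      exact hwT (Finset.mem_filter.2 ⟨hwA, ((Finset.mem_filter.1 hz).2.tail
        (Graph.mem_neighborsIn.1 hyz).2).tail (Graph.mem_neighborsIn.1 hyw).2.symm⟩)
    have h3 := Finset.card_le_card (Finset.union_subset (hG.biUnion_subset hTs)
      (hG.biUnion_subset (Finset.sdiff_subset (s := A) (t := T))))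
    rw [Finset.card_union_of_disjoint hd] at h3
    have := Finset.card_sdiff_add_card_eq_card hTs
    omega
  have hall : ∀ a ∈ A, Relation.ReflTransGen G.Adj x a := fun a ha ↦ by
    rw [← hTA] at ha
    exact (Finset.mem_filter.1 ha).2
  intro y hy
  rcases h.mem_vertexSet.1 hy with hy | hy
  · exact hall y hy
  · obtain ⟨a, ha, hay⟩ := hnb y hy
    exact (hall a ha).tail hay

/-- For an edge `ab`, the surplus of one neighbour pays for removing `b`, so Hall's condition holds
between `A.erase a` and `B.erase b`. -/
lemma isMatchingCovered_of_expanding (h : G.IsBipartition (A : Set α) B)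
    (hG : Expanding A B (G.neighborsIn B)) : G.IsMatchingCovered := by
  have hA := hG.two_le
  have hB := hG.card_eq
  refine ⟨isConnected_of_expanding h hG, by rw [h.ncard_vertexSet]; omega, fun e he ↦ ?_⟩
  obtain ⟨a, ha, b, hb, hab⟩ := h.exists_isLink he
  obtain ⟨f, hf, hfm⟩ := (Finset.all_card_le_biUnion_card_iff_exists_injective
    (fun x : {x // x ∈ A.erase a} ↦ (G.neighborsIn B x).erase b)).1 (by
      intro s
      rcases s.eq_empty_or_nonempty with rfl | hs
      · simp
      set s' := s.map (Function.Embedding.subtype _) with hs'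
      have hs'A : s' ⊆ A.erase a := fun x hx ↦ by
        obtain ⟨z, -, rfl⟩ := Finset.mem_map.1 hx
        exact z.2
      have h1 := hG.lt_card s' (hs'A.trans (Finset.erase_subset _ _)) (hs.map) (fun h' ↦ by
        have : a ∈ s' := h'.symm ▸ ha
        simpa using hs'A this)
      have h2 : (s'.biUnion (G.neighborsIn B)).erase b ⊆
          s.biUnion fun x ↦ (G.neighborsIn B x).erase b := by
        intro y hy
        obtain ⟨hyb, hy⟩ := Finset.mem_erase.1 hy
        obtain ⟨z, hz, hyz⟩ := Finset.mem_biUnion.1 hy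
        obtain ⟨z, hz', rfl⟩ := Finset.mem_map.1 hz
        exact Finset.mem_biUnion.2 ⟨z, hz', Finset.mem_erase.2 ⟨hyb, hyz⟩⟩
      have h3 := Finset.card_le_card h2
      have h4 := Finset.pred_card_le_card_erase (s := s'.biUnion (G.neighborsIn B)) (a := b)
      have h5 : #s' = #s := Finset.card_map _
      omega)
  have hfm' : ∀ x (hx : x ∈ A.erase a), f ⟨x, hx⟩ ≠ b ∧ G.Adj x (f ⟨x, hx⟩) := fun x hx ↦ by
    have := hfm ⟨x, hx⟩
    rw [Finset.mem_erase, Graph.mem_neighborsIn] at this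
    exact ⟨this.1, this.2.2⟩
  let F : α → α := fun x ↦ if hx : x ∈ A.erase a then f ⟨x, hx⟩ else b
  have hFa : F a = b := dif_neg (by simp)
  have hFn : ∀ x (hx : x ∈ A.erase a), F x = f ⟨x, hx⟩ := fun x hx ↦ dif_pos hx
  -- With parallel edges the partner `b` does not determine the edge, so the choice at `a` is pinned
  -- to `e`.
  have hex : ∀ x ∈ A, ∃ e', G.IsLink e' x (F x) ∧ (x = a → e' = e) := by
    intro x hx
    by_cases hxa : x = a
    · subst hxa
      exact ⟨e, hFa.symm ▸ hab, fun _ ↦ rfl⟩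
    · have hx' : x ∈ A.erase a := Finset.mem_erase.2 ⟨hxa, hx⟩
      obtain ⟨e', he'⟩ := (hfm' x hx').2
      exact ⟨e', (hFn x hx').symm ▸ he', fun h' ↦ (hxa h').elim⟩
  have : Nonempty β := ⟨e⟩
  choose! ε hε hεa using hex
  refine ⟨ε '' A, isPerfectMatching_image h hB (f := F) (fun x hx y hy hxy ↦ ?_) hε,
    ⟨a, ha, hεa a ha rfl⟩⟩
  by_cases hxa : x = a <;> by_cases hya : y = a
  · rw [hxa, hya]
  · have hy' : y ∈ A.erase a := Finset.mem_erase.2 ⟨hya, hy⟩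
    rw [hxa, hFa, hFn y hy'] at hxy
    exact ((hfm' y hy').1 hxy.symm).elim
  · have hx' : x ∈ A.erase a := Finset.mem_erase.2 ⟨hxa, hx⟩
    rw [hya, hFa, hFn x hx'] at hxy
    exact ((hfm' x hx').1 hxy).elim
  · have hx' : x ∈ A.erase a := Finset.mem_erase.2 ⟨hxa, hx⟩
    have hy' : y ∈ A.erase a := Finset.mem_erase.2 ⟨hya, hy⟩
    rw [hFn x hx', hFn y hy'] at hxy
    simpa using hf hxy

/-- Hall-type characterization of matching covered bipartite graphs. -/
theorem isMatchingCovered_iff_expanding (h : G.IsBipartition (A : Set α) B) :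
    G.IsMatchingCovered ↔ Expanding A B (G.neighborsIn B) :=
  ⟨fun hG ↦ hG.expanding h, isMatchingCovered_of_expanding h⟩

/-- A minimal matching covered bipartite graph has no parallel edges. -/
lemma IsMinimalMatchingCovered.eq_of_isLink (h : G.IsBipartition (A : Set α) B)
    (hG : G.IsMinimalMatchingCovered) {e e' : β} {x y : α} (hx : x ∈ A) (he : G.IsLink e x y)
    (he' : G.IsLink e' x y) : e = e' := by
  by_contra hne
  refine hG.minimal e he.edge_mem ((isMatchingCovered_iff_expanding (h.deleteEdges _)).2 ?_)
  have : (G.deleteEdges {e}).neighborsIn B = G.neighborsIn B := by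
    ext z w
    simp only [Graph.mem_neighborsIn, and_congr_right_iff]
    intro _
    refine ⟨fun ⟨f, hf⟩ ↦ ⟨f, hf.1⟩, fun ⟨f, hf⟩ ↦ ?_⟩
    by_cases hfe : f = e
    · subst hfe
      refine ⟨e', ?_, fun h' ↦ hne h'.symm⟩
      rcases hf.eq_and_eq_or_eq_and_eq he with ⟨rfl, rfl⟩ | ⟨rfl, rfl⟩
      · exact he'
      · exact he'.symm
    · exact ⟨f, hf, hfe⟩
  rw [this]
  exact hG.matchingCovered.expanding h

/-- A set whose expansion fails after deleting `e` loses exactly the neighbour `b`, so it was tight,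
contains `a`, and reaches `b` only through `a`. -/
lemma IsMinimalMatchingCovered.minimalExpanding (h : G.IsBipartition (A : Set α) B)
    (hG : G.IsMinimalMatchingCovered) : MinimalExpanding A B (G.neighborsIn B) := by
  have hexp := hG.matchingCovered.expanding h
  refine ⟨hexp, fun a ha b hb ↦ ?_⟩
  obtain ⟨e, he⟩ := (h.mem_neighborsIn ha).1 hb
  by_contra! hno
  refine hG.minimal e he.edge_mem ((isMatchingCovered_iff_expanding (h.deleteEdges _)).2 ?_)
  refine ⟨hexp.two_le, hexp.card_eq, fun x _ y hy ↦ (Graph.mem_neighborsIn.1 hy).1,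
    fun T hT hT0 hTA ↦ ?_⟩
  have hkeep : ∀ x ∈ A, ∀ y ∈ G.neighborsIn B x, (x = a → y ≠ b) →
      y ∈ (G.deleteEdges {e}).neighborsIn B x := by
    intro x hx y hy hxy
    obtain ⟨hyB, f, hf⟩ := Graph.mem_neighborsIn.1 hy
    refine Graph.mem_neighborsIn.2 ⟨hyB, f, hf, fun hfe ↦ ?_⟩
    obtain rfl : f = e := hfe
    rcases hf.eq_and_eq_or_eq_and_eq he with ⟨rfl, rfl⟩ | ⟨rfl, rfl⟩
    · exact hxy rfl rfl
    · exact h.disjoint.le_bot ⟨ha, hyB⟩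
  have h1 := hexp.lt_card T hT hT0 hTA
  by_contra hlt
  have hsub : T.biUnion (G.neighborsIn B) ⊆
      insert b (T.biUnion ((G.deleteEdges {e}).neighborsIn B)) := by
    intro y hy
    obtain ⟨x, hx, hyx⟩ := Finset.mem_biUnion.1 hy
    by_cases hyb : y = b
    · exact Finset.mem_insert.2 (.inl hyb)
    · exact Finset.mem_insert_of_mem
        (Finset.mem_biUnion.2 ⟨x, hx, hkeep x (hT hx) y hyx fun _ ↦ hyb⟩)
  have h2 := Finset.card_le_card hsub
  have h3 := Finset.card_insert_le b (T.biUnion ((G.deleteEdges {e}).neighborsIn B))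
  have hbn : b ∉ T.biUnion ((G.deleteEdges {e}).neighborsIn B) := fun hbm ↦ by
    rw [Finset.insert_eq_of_mem hbm] at h2
    omega
  have hpriv : ∀ x ∈ T, b ∈ G.neighborsIn B x → x = a := by
    intro x hx hbx
    by_contra hxa
    exact hbn (Finset.mem_biUnion.2 ⟨x, hx, hkeep x (hT hx) b hbx fun h' ↦ (hxa h').elim⟩)
  refine hno T ⟨⟨hT, hTA, by omega⟩, ?_, hpriv⟩
  by_contra haT
  have hsub' : T.biUnion (G.neighborsIn B) ⊆ T.biUnion ((G.deleteEdges {e}).neighborsIn B) := by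
    intro y hy
    obtain ⟨x, hx, hyx⟩ := Finset.mem_biUnion.1 hy
    exact Finset.mem_biUnion.2 ⟨x, hx, hkeep x (hT hx) y hyx fun h' ↦ (haT (h' ▸ hx)).elim⟩
  have := Finset.card_le_card hsub'
  omega

lemma IsMinimalMatchingCovered.ncard_incidenceSet (h : G.IsBipartition (A : Set α) B)
    (hG : G.IsMinimalMatchingCovered) {x : α} (hx : x ∈ A) :
    (G.incidenceSet x).ncard = #(G.neighborsIn B x) := by
  rw [← Set.ncard_coe_finset]
  refine Set.ncard_congr' ?_
  refine Equiv.ofBijective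
    (fun e ↦ ⟨e.2.other, (h.mem_neighborsIn hx).2 e.2.isLink_other.adj⟩) ⟨?_, ?_⟩
  · intro e e' hee
    have h1 := e.2.isLink_other
    have h2 := e'.2.isLink_other
    rw [show e.2.other = e'.2.other from congrArg Subtype.val hee] at h1
    exact Subtype.ext (hG.eq_of_isLink h hx h1 h2)
  · rintro ⟨y, hy⟩
    obtain ⟨e, he⟩ := (h.mem_neighborsIn hx).1 hy
    exact ⟨⟨e, he.inc_left⟩, Subtype.ext ((Inc.isLink_other he.inc_left).right_unique he)⟩

lemma IsBipartition.sum_ncard_incidenceSet (h : G.IsBipartition (A : Set α) B)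
    (hE : E(G).Finite) : ∑ x ∈ A, (G.incidenceSet x).ncard = E(G).ncard := by
  classical
  have hfin : ∀ x, (G.incidenceSet x).Finite := fun x ↦ hE.subset fun e he ↦ Inc.edge_mem he
  have hEq : E(G) = ↑(A.biUnion fun x ↦ (hfin x).toFinset) := by
    ext e
    simp only [Finset.coe_biUnion, Set.Finite.coe_toFinset, Set.mem_iUnion]
    constructor
    · intro he
      obtain ⟨x, hx, y, -, hl⟩ := h.exists_isLink he
      exact ⟨x, hx, hl.inc_left⟩
    · rintro ⟨x, -, he⟩
      exact Inc.edge_mem he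
  rw [hEq, Set.ncard_coe_finset, Finset.card_biUnion]
  · exact Finset.sum_congr rfl fun x _ ↦ Set.ncard_eq_toFinset_card _ (hfin x)
  · intro x hx y hy hxy
    refine Finset.disjoint_left.2 fun e hex hey ↦ ?_
    obtain ⟨z, hz⟩ : G.Inc e x := (hfin x).mem_toFinset.1 hex
    have hey : G.Inc e y := (hfin y).mem_toFinset.1 hey
    rcases hey.eq_or_eq_of_isLink hz with h' | h'
    · exact hxy h'.symm
    · exact h.disjoint.le_bot ⟨hy, h' ▸ h.right_mem hz hx⟩

open scoped Classical in
-- Since `weight d` is `d - 2`, less one when `d = 2`, and the degrees over `A` sum to the number of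
-- edges, this is the weight inequality rewritten.
lemma IsMinimalMatchingCovered.le_card_filter (h : G.IsBipartition (A : Set α) B)
    (hG : G.IsMinimalMatchingCovered) (hE : E(G).Finite) :
    (E(G).ncard : ℤ) - 2 * #A + 2 ≤ #(A.filter fun x ↦ (G.incidenceSet x).ncard = 2) := by
  have h1 := (hG.minimalExpanding h).sum_weight_le
  have h2 := h.sum_ncard_incidenceSet hE
  have h3 : ∀ x ∈ A, weight #(G.neighborsIn B x) =
      (((G.incidenceSet x).ncard : ℤ) - 2) -
        if (G.incidenceSet x).ncard = 2 then 1 else 0 := by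
    intro x hx
    rw [← hG.ncard_incidenceSet h hx, weight]
    split_ifs with h'
    · rw [h']; norm_num
    · ring
  rw [Finset.sum_congr rfl h3, Finset.sum_sub_distrib, Finset.sum_sub_distrib, ← Nat.cast_sum, h2,
    Finset.sum_boole] at h1
  simp only [Finset.sum_const, nsmul_eq_mul] at h1
  linarith

end criterion

/-- A minimal matching covered bipartite graph has at least `2 (m - n + 2)` vertices of
degree two. -/
theorem IsMinimalMatchingCovered.le_ncard_degreeTwoSet (hG : G.IsMinimalMatchingCovered)
    (hb : G.IsBipartite) (hV : V(G).Finite) (hE : E(G).Finite) :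
    2 * ((E(G).ncard : ℤ) - V(G).ncard + 2) ≤ G.degreeTwoSet.ncard := by
  classical
  obtain ⟨A, B, h⟩ := hb
  lift A to Finset α using hV.subset (h.union_eq ▸ Set.subset_union_left)
  lift B to Finset α using hV.subset (h.union_eq ▸ Set.subset_union_right)
  have h1 := hG.le_card_filter h hE
  have h2 := hG.le_card_filter h.symm hE
  have h3 : G.degreeTwoSet = ↑((A.filter fun x ↦ (G.incidenceSet x).ncard = 2) ∪
      (B.filter fun x ↦ (G.incidenceSet x).ncard = 2)) := by
    ext x
    simp only [degreeTwoSet, Set.mem_ofPred_eq, h.mem_vertexSet, Finset.coe_union,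
      Finset.coe_filter, Set.mem_union]
    tauto
  rw [h3, Set.ncard_coe_finset, Finset.card_union_of_disjoint, h.ncard_vertexSet]
  · push_cast
    linarith
  · exact (Finset.disjoint_coe.1 h.disjoint).mono (Finset.filter_subset _ _)
      (Finset.filter_subset _ _)

end Graph

/-! ### Adding an ear of length three -/

namespace Graph

set_option linter.unusedSectionVars false

open BipartiteExpansion
open scoped Finset

variable {α β : Type*} {G H : Graph α β} {a b : α}

section addEar

lemma addEar_isLink_inl {e : β} {x y : α ⊕ Fin 2} : (H.addEar a b).IsLink (.inl e) x y ↔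
    ∃ x' y', H.IsLink e x' y' ∧ x = .inl x' ∧ y = .inl y' := Iff.rfl

lemma addEar_isLink_inr {i : Fin 3} {x y : α ⊕ Fin 2} :
    (H.addEar a b).IsLink (.inr i) x y ↔ s(x, y) = earEnds a b i := Iff.rfl

lemma vertexSet_addEar (ha : a ∈ V(H)) (hb : b ∈ V(H)) :
    V(H.addEar a b) = Sum.inl '' V(H) ∪ Set.range Sum.inr := by
  change Sum.inl '' (V(H) ∪ {a, b}) ∪ Set.range Sum.inr = _
  rw [Set.union_eq_self_of_subset_right (Set.pair_subset ha hb)]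

lemma edgeSet_addEar : E(H.addEar a b) = Sum.inl '' E(H) ∪ Set.range Sum.inr := rfl

lemma addEar_isLink_inl_inl {e : β} {x y : α} :
    (H.addEar a b).IsLink (.inl e) (.inl x) (.inl y) ↔ H.IsLink e x y := by
  simp [addEar_isLink_inl]

lemma addEar_adj_inl_inl {x y : α} : (H.addEar a b).Adj (.inl x) (.inl y) ↔ H.Adj x y := by
  constructor
  · rintro ⟨e | i, h⟩
    · exact ⟨e, addEar_isLink_inl_inl.1 h⟩
    · rw [addEar_isLink_inr] at h
      fin_cases i <;> simp [earEnds] at h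
  · rintro ⟨e, h⟩
    exact ⟨.inl e, addEar_isLink_inl_inl.2 h⟩

lemma addEar_adj_inl_zero {x : α} : (H.addEar a b).Adj (.inl x) (.inr 0) ↔ x = a := by
  constructor
  · rintro ⟨e | i, h⟩
    · simp [addEar_isLink_inl] at h
    · rw [addEar_isLink_inr] at h
      fin_cases i <;> simp [earEnds] at h
      exact h
  · rintro rfl
    exact ⟨.inr 0, by simp [addEar_isLink_inr, earEnds]⟩

lemma addEar_adj_one_zero : (H.addEar a b).Adj (.inr 1) (.inr 0) :=
  ⟨.inr 1, by simp [addEar_isLink_inr, earEnds]⟩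

lemma addEar_adj_one_inl {y : α} : (H.addEar a b).Adj (.inr 1) (.inl y) ↔ y = b := by
  constructor
  · rintro ⟨e | i, h⟩
    · simp [addEar_isLink_inl] at h
    · rw [addEar_isLink_inr] at h
      fin_cases i <;> simp [earEnds] at h
      exact h
  · rintro rfl
    exact ⟨.inr 2, by simp [addEar_isLink_inr, earEnds]⟩

lemma deleteEdges_addEar (e : β) :
    (H.addEar a b).deleteEdges {.inl e} = (H.deleteEdges {e}).addEar a b := by
  refine Graph.ext rfl fun f x y ↦ ?_
  rcases f with f | i
  · simp only [deleteEdges_isLink, addEar_isLink_inl, Set.mem_singleton_iff, Sum.inl.injEq]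
    grind
  · simp [deleteEdges_isLink, addEar_isLink_inr]

lemma deleteEdges_induce (e : β) (X : Set α) :
    (G.induce X).deleteEdges {e} = (G.deleteEdges {e}).induce X := by
  refine Graph.ext rfl fun f x y ↦ ?_
  simp only [deleteEdges_isLink, induce_isLink]
  tauto

variable [DecidableEq α] {A B : Finset α}

/-- The new vertex `Sum.inr 0` is adjacent to `a` and so joins `B`; `Sum.inr 1` is adjacent to `b`
and joins `A`. -/
lemma IsBipartition.addEar (h : H.IsBipartition (A : Set α) B) (ha : a ∈ A) (hb : b ∈ B) :
    (H.addEar a b).IsBipartition (A.disjSum {1} : Finset (α ⊕ Fin 2))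
      (B.disjSum {0} : Finset (α ⊕ Fin 2)) := by
  refine ⟨?_, ?_, ?_⟩
  · rw [Set.disjoint_left]
    rintro (x | i) hx hy
    · simp only [Finset.mem_coe, Finset.inl_mem_disjSum] at hx hy
      exact h.disjoint.le_bot ⟨hx, hy⟩
    · simp only [Finset.mem_coe, Finset.inr_mem_disjSum, Finset.mem_singleton] at hx hy
      simp [hx] at hy
  · rw [vertexSet_addEar (h.mem_vertexSet.2 (.inl ha)) (h.mem_vertexSet.2 (.inr hb))]
    ext (x | i)
    · simp [h.mem_vertexSet]
    · fin_cases i <;> simp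
  · rintro (e | i) x y hl
    · obtain ⟨x, y, hl, rfl, rfl⟩ := hl
      simpa using h.of_isLink hl
    · rw [addEar_isLink_inr] at hl
      fin_cases i <;> simp [earEnds] at hl <;> rcases hl with ⟨rfl, rfl⟩ | ⟨rfl, rfl⟩ <;>
        simp [ha, hb]

lemma neighborsIn_addEar_inl (x : α) :
    (H.addEar a b).neighborsIn (B.disjSum {0}) (.inl x) =
      (H.neighborsIn B x).disjSum (if x = a then {0} else ∅) := by
  ext (y | i)
  · simp [Graph.mem_neighborsIn, addEar_adj_inl_inl]
  · simp only [Graph.mem_neighborsIn, Finset.inr_mem_disjSum, Finset.mem_singleton]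
    constructor
    · rintro ⟨rfl, h⟩
      rw [if_pos (addEar_adj_inl_zero.1 h)]
      simp
    · intro h
      split_ifs at h with hx
      · obtain rfl : i = 0 := by simpa using h
        exact ⟨rfl, addEar_adj_inl_zero.2 hx⟩
      · simp at h

lemma neighborsIn_addEar_one (hb : b ∈ B) :
    (H.addEar a b).neighborsIn (B.disjSum {0}) (.inr 1) = Finset.disjSum {b} {0} := by
  ext (y | i)
  · simp only [Graph.mem_neighborsIn, Finset.inl_mem_disjSum, addEar_adj_one_inl,
      Finset.mem_singleton]
    exact ⟨fun h ↦ h.2, by rintro rfl; exact ⟨hb, rfl⟩⟩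
  · simp only [Graph.mem_neighborsIn, Finset.inr_mem_disjSum, Finset.mem_singleton]
    exact ⟨fun h ↦ h.1, by rintro rfl; exact ⟨rfl, addEar_adj_one_zero⟩⟩

lemma biUnion_neighborsIn_addEar_left (T : Finset α) :
    (T.disjSum (∅ : Finset (Fin 2))).biUnion ((H.addEar a b).neighborsIn (B.disjSum {0})) =
      (T.biUnion (H.neighborsIn B)).disjSum (if a ∈ T then {0} else ∅) := by
  ext y
  simp only [Finset.mem_biUnion, Sum.exists, Finset.inl_mem_disjSum, Finset.inr_mem_disjSum,
    Finset.notMem_empty, false_and, exists_false, or_false, neighborsIn_addEar_inl]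
  rcases y with y | i
  · simp
  · simp only [Finset.inr_mem_disjSum]
    constructor
    · rintro ⟨x, hx, hi⟩
      split_ifs at hi with hxa
      · subst hxa; rwa [if_pos hx]
      · simp at hi
    · intro hi
      split_ifs at hi with haT
      · exact ⟨a, haT, by rwa [if_pos rfl]⟩
      · simp at hi

lemma biUnion_neighborsIn_addEar_one (hb : b ∈ B) (T : Finset α) :
    (T.disjSum ({1} : Finset (Fin 2))).biUnion ((H.addEar a b).neighborsIn (B.disjSum {0})) =
      (insert b (T.biUnion (H.neighborsIn B))).disjSum {0} := by
  have : T.disjSum ({1} : Finset (Fin 2)) = insert (.inr 1) (T.disjSum ∅) := by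
    ext (x | i) <;> simp
  rw [this, Finset.biUnion_insert, biUnion_neighborsIn_addEar_left, neighborsIn_addEar_one hb]
  ext (y | i)
  · simp
  · simp only [Finset.mem_union, Finset.inr_mem_disjSum, or_iff_left_iff_imp]
    intro h
    split_ifs at h with haT
    · exact h
    · simp at h

/-- Adding an ear of length three gives a matching covered graph exactly under the relative
expansion property. -/
lemma isMatchingCovered_addEar_iff (h : H.IsBipartition (A : Set α) B) (ha : a ∈ A) (hb : b ∈ B) :
    (H.addEar a b).IsMatchingCovered ↔ EarExpanding A B (H.neighborsIn B) a b := by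
  rw [isMatchingCovered_iff_expanding (h.addEar ha hb)]
  constructor
  · intro hx
    have hc := hx.card_eq
    simp only [Finset.card_disjSum, Finset.card_singleton] at hc
    refine ⟨by omega, fun T hT hT0 ↦ ?_, fun T hT hTA ↦ ?_⟩
    · have := hx.lt_card (T.disjSum ∅) (Finset.disjSum_mono hT (Finset.empty_subset _))
        (by obtain ⟨t, ht⟩ := hT0; exact ⟨.inl t, by simpa⟩)
        (fun h' ↦ by
          have : (Sum.inr 1 : α ⊕ Fin 2) ∈ T.disjSum ∅ := h' ▸ by simp
          simp at this)
      rw [biUnion_neighborsIn_addEar_left, Finset.card_disjSum, Finset.card_disjSum] at this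
      split_ifs at this ⊢ <;> simpa using this
    · have := hx.lt_card (T.disjSum {1}) (Finset.disjSum_mono hT subset_rfl)
        ⟨.inr 1, by simp⟩ (fun h' ↦ hTA (by
          ext x
          have := Finset.ext_iff.1 h' (.inl x)
          simpa using this))
      rw [biUnion_neighborsIn_addEar_one hb, Finset.card_disjSum, Finset.card_disjSum] at this
      simpa using this
  · intro hx
    have hA := Finset.card_pos.2 ⟨a, ha⟩
    refine ⟨by rw [Finset.card_disjSum, Finset.card_singleton]; omega, by simp [hx.card_eq],
      fun x _ y hy ↦ (Graph.mem_neighborsIn.1 hy).1,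
      fun T hT hT0 hTA ↦ ?_⟩
    have hTl : T.toLeft ⊆ A := fun x hx ↦ by
      simpa using hT (Finset.mem_toLeft.1 hx)
    have hTr : T.toRight ⊆ {1} := fun x hx ↦ by
      simpa using hT (Finset.mem_toRight.1 hx)
    rw [← Finset.toLeft_disjSum_toRight (u := T)] at hT0 hTA ⊢
    -- Sets avoiding `Sum.inr 1` are governed by `le_add`, where `Sum.inr 0` is the extra unit; sets
    -- containing it by `le_insert`, where `Sum.inr 0` offsets `Sum.inr 1`.
    rcases Finset.subset_singleton_iff.1 hTr with hr | hr
    · rw [hr] at hT0 ⊢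
      rw [biUnion_neighborsIn_addEar_left, Finset.card_disjSum, Finset.card_disjSum]
      have := hx.le_add T.toLeft hTl (by
        obtain ⟨x | i, hx⟩ := hT0
        · exact ⟨x, by simpa using hx⟩
        · simp at hx)
      split_ifs at this ⊢ <;> simpa using this
    · rw [hr] at hTA ⊢
      rw [biUnion_neighborsIn_addEar_one hb, Finset.card_disjSum, Finset.card_disjSum]
      have := hx.le_insert T.toLeft hTl fun h' ↦ hTA (by rw [h'])
      simpa using this

/-- The edges of the added ear cannot be deleted. -/
lemma not_isMatchingCovered_addEar_deleteEdges (h : H.IsBipartition (A : Set α) B) (ha : a ∈ A)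
    (hb : b ∈ B) (i : Fin 3) : ¬ ((H.addEar a b).deleteEdges {.inr i}).IsMatchingCovered := by
  intro hm
  have hbip := (h.addEar ha hb).deleteEdges {.inr i}
  have h1 := (hm.expanding hbip).two_le_card (a := .inr 1) (by simp)
  have h0 := (hm.expanding hbip.symm).two_le_card (a := .inr 0) (by simp)
  have key : ∀ {C : Finset (α ⊕ Fin 2)} {u v : α ⊕ Fin 2},
      (∀ j y, j ≠ i → s(u, y) = earEnds a b j → y = v) → (∃ k, u = .inr k) →
      ¬ 2 ≤ #(((H.addEar a b).deleteEdges {.inr i}).neighborsIn C u) := by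
    intro C u v huv ⟨k, hk⟩ hle
    have : ((H.addEar a b).deleteEdges {.inr i}).neighborsIn C u ⊆ {v} := by
      intro y hy
      obtain ⟨-, e, he⟩ := Graph.mem_neighborsIn.1 hy
      rw [deleteEdges_isLink] at he
      rcases e with e | j
      · obtain ⟨x', y', -, hx, -⟩ := he.1
        simp [hk] at hx
      · exact Finset.mem_singleton.2 (huv j y (fun h' ↦ he.2 (by simp [h'])) he.1)
    have := Finset.card_le_card this
    simp at this
    omega
  -- Deleting any ear edge leaves a new vertex with a single neighbour, named by `v`.
  fin_cases i
  · refine key (v := .inr 1) (fun j y hj hy ↦ ?_) ⟨_, rfl⟩ h0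
    fin_cases j <;> simp [earEnds] at hj hy ⊢; exact hy
  · refine key (v := .inl b) (fun j y hj hy ↦ ?_) ⟨_, rfl⟩ h1
    fin_cases j <;> simp [earEnds] at hj hy ⊢; exact hy
  · refine key (v := .inr 0) (fun j y hj hy ↦ ?_) ⟨_, rfl⟩ h1
    fin_cases j <;> simp [earEnds] at hj hy ⊢; exact hy

end addEar

end Graph

/-! ### Balanced 2-cuts: matching covered and minimal graphs -/

namespace Graph

set_option linter.unusedSectionVars false

open BipartiteExpansion
open scoped Finset

variable {α β : Type*} {G : Graph α β}

/-- The edges of `∂(X)` are `f₁ = a₁b₂` and `f₂ = b₁a₂`, where `a₁, b₁ ∈ X`. -/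
structure CrossesAt (G : Graph α β) (A B X : Set α) (a₁ b₁ a₂ b₂ : α) (f₁ f₂ : β) : Prop where
  subset : X ⊆ V(G)
  mem_a₁ : a₁ ∈ A ∩ X
  mem_b₁ : b₁ ∈ B ∩ X
  mem_a₂ : a₂ ∈ A \ X
  mem_b₂ : b₂ ∈ B \ X
  isLink₁ : G.IsLink f₁ a₁ b₂
  isLink₂ : G.IsLink f₂ b₁ a₂
  of_isLink : ∀ ⦃e x y⦄, G.IsLink e x y → x ∈ X → y ∉ X →
    (e = f₁ ∧ x = a₁ ∧ y = b₂) ∨ (e = f₂ ∧ x = b₁ ∧ y = a₂)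

/-- Balance leaves one cut edge whose end in `X` is in `A` and one whose end in `X` is in `B`.
Colours then pair the prescribed ends: the edge at `b₂ ∈ B` has its inner end in `A`, so it is the
edge at `a₁`. -/
lemma IsTwoCutDecomposition.exists_crossesAt {A B X : Set α}
    {G₁ G₂ : Graph (α ⊕ Fin 2) (β ⊕ Fin 3)} (hAB : G.IsBipartition A B) (hE : E(G).Finite)
    (h : G.IsTwoCutDecomposition A B X G₁ G₂) :
    ∃ a₁ b₁ a₂ b₂ f₁ f₂, G.CrossesAt A B X a₁ b₁ a₂ b₂ f₁ f₂ ∧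
      G₁ = (G.induce X).addEar a₁ b₁ ∧ G₂ = (G.induce (V(G) \ X)).addEar a₂ b₂ := by
  obtain ⟨⟨hX, hc, hbal⟩, a₁, ha₁, b₁, hb₁, a₂, ha₂, b₂, hb₂, he₁, he₂, he₃, he₄, h₁, h₂⟩ := h
  have hcut : G.cut X = G.cutFrom A X ∪ G.cutFrom B X := by
    ext e
    constructor
    · rintro ⟨x, y, hl, hx, hy⟩
      rcases hAB.of_isLink hl with h' | h'
      · exact .inl ⟨x, y, hl, hx, hy, h'.1⟩
      · exact .inr ⟨x, y, hl, hx, hy, h'.1⟩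
    · rintro (⟨x, y, hl, hx, hy, -⟩ | ⟨x, y, hl, hx, hy, -⟩) <;> exact ⟨x, y, hl, hx, hy⟩
  have hfin : ∀ C, (G.cutFrom C X).Finite := fun C ↦ hE.subset fun e ⟨_, _, hl, _⟩ ↦ hl.edge_mem
  have hdisj : Disjoint (G.cutFrom A X) (G.cutFrom B X) := by
    rw [Set.disjoint_left]
    rintro e ⟨x, y, hl, hx, hy, hxA⟩ ⟨x', y', hl', hx', hy', hxB⟩
    rcases hl.left_eq_or_eq hl' with rfl | rfl
    · exact hAB.disjoint.le_bot ⟨hxA, hxB⟩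
    · exact hy' hx
  rw [hcut, Set.ncard_union_eq hdisj (hfin A) (hfin B)] at hc
  obtain ⟨f₁, hf₁⟩ := Set.ncard_eq_one.1 (show (G.cutFrom A X).ncard = 1 by omega)
  obtain ⟨f₂, hf₂⟩ := Set.ncard_eq_one.1 (show (G.cutFrom B X).ncard = 1 by omega)
  have hin : ∀ z ∈ X, (∃ e ∈ G.cut X, G.Inc e z) → ∃ e y, G.IsLink e z y ∧ y ∉ X := by
    rintro z hz ⟨e, ⟨x, y, hl, hx, hy⟩, hinc⟩
    rcases hinc.eq_or_eq_of_isLink hl with rfl | rfl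
    · exact ⟨e, y, hl, hy⟩
    · exact (hy hz).elim
  have hout : ∀ z ∉ X, (∃ e ∈ G.cut X, G.Inc e z) → ∃ e x, G.IsLink e x z ∧ x ∈ X := by
    rintro z hz ⟨e, ⟨x, y, hl, hx, hy⟩, hinc⟩
    rcases hinc.eq_or_eq_of_isLink hl with rfl | rfl
    · exact (hz hx).elim
    · exact ⟨e, x, hl, hx⟩
  have hA : ∀ e x y, G.IsLink e x y → x ∈ X → y ∉ X → x ∈ A → e = f₁ := fun e x y hl hx hy hxA ↦ by
    have : e ∈ G.cutFrom A X := ⟨x, y, hl, hx, hy, hxA⟩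
    rwa [hf₁] at this
  have hB : ∀ e x y, G.IsLink e x y → x ∈ X → y ∉ X → x ∈ B → e = f₂ := fun e x y hl hx hy hxA ↦ by
    have : e ∈ G.cutFrom B X := ⟨x, y, hl, hx, hy, hxA⟩
    rwa [hf₂] at this
  have huniq : ∀ e x y x' y', G.IsLink e x y → G.IsLink e x' y' → x ∈ X → y' ∉ X →
      x = x' ∧ y = y' := by
    intro e x y x' y' hl hl' hx hy'
    rcases hl.eq_and_eq_or_eq_and_eq hl' with h' | ⟨rfl, -⟩
    · exact h'
    · exact (hy' hx).elim
  have hl₁ : G.IsLink f₁ a₁ b₂ := by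
    obtain ⟨e, y, hl, hy⟩ := hin a₁ ha₁.2 he₁
    obtain ⟨e', x, hl', hx⟩ := hout b₂ hb₂.2 he₄
    obtain rfl := hA e a₁ y hl ha₁.2 hy ha₁.1
    obtain rfl := hA e' x b₂ hl' hx hb₂.2 (hAB.left_mem hl' hb₂.1)
    obtain ⟨-, rfl⟩ := huniq _ _ _ _ _ hl hl' ha₁.2 hb₂.2
    exact hl
  have hl₂ : G.IsLink f₂ b₁ a₂ := by
    obtain ⟨e, y, hl, hy⟩ := hin b₁ hb₁.2 he₂
    obtain ⟨e', x, hl', hx⟩ := hout a₂ ha₂.2 he₃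
    obtain rfl := hB e b₁ y hl hb₁.2 hy hb₁.1
    obtain rfl := hB e' x a₂ hl' hx ha₂.2 (hAB.symm.left_mem hl' ha₂.1)
    obtain ⟨-, rfl⟩ := huniq _ _ _ _ _ hl hl' hb₁.2 ha₂.2
    exact hl
  refine ⟨a₁, b₁, a₂, b₂, f₁, f₂, ⟨hX, ha₁, hb₁, ha₂, hb₂, hl₁, hl₂, fun e x y hl hx hy ↦ ?_⟩,
    h₁, h₂⟩
  rcases hAB.of_isLink hl with h' | h'
  · obtain rfl := hA e x y hl hx hy h'.1
    exact .inl ⟨rfl, huniq _ _ _ _ _ hl hl₁ hx hb₂.2⟩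
  · obtain rfl := hB e x y hl hx hy h'.1
    exact .inr ⟨rfl, huniq _ _ _ _ _ hl hl₂ hx ha₂.2⟩

open scoped Classical in
/-- The members of `C` that belong to `X`. -/
noncomputable def part (C : Finset α) (X : Set α) : Finset α := C.filter (· ∈ X)

lemma mem_part {C : Finset α} {X : Set α} {x : α} : x ∈ part C X ↔ x ∈ C ∧ x ∈ X := by
  simp [part]

lemma part_subset {C : Finset α} {X : Set α} : part C X ⊆ C := fun _ hx ↦ (mem_part.1 hx).1

lemma deleteEdges_induce_compl {X : Set α} {e : β} (he : e ∈ E(G.induce X)) :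
    (G.deleteEdges {e}).induce (V(G) \ X) = G.induce (V(G) \ X) := by
  obtain ⟨u, v, hl, hu, hv⟩ := he
  refine Graph.ext rfl fun f x y ↦ ?_
  simp only [induce_isLink, deleteEdges_isLink, Set.mem_singleton_iff]
  refine ⟨fun h' ↦ ⟨h'.1.1, h'.2⟩, fun h' ↦ ⟨⟨h'.1, ?_⟩, h'.2⟩⟩
  rintro rfl
  rcases h'.1.left_eq_or_eq hl with rfl | rfl
  · exact h'.2.1.2 hu
  · exact h'.2.1.2 hv

lemma deleteEdges_induce_of_mem_compl {X : Set α} (hX : X ⊆ V(G)) {e : β}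
    (he : e ∈ E(G.induce (V(G) \ X))) : (G.deleteEdges {e}).induce X = G.induce X := by
  have := deleteEdges_induce_compl he
  rwa [Set.sdiff_sdiff_cancel_left hX] at this

namespace CrossesAt

section basic

variable {A B X : Set α} {a₁ b₁ a₂ b₂ : α} {f₁ f₂ : β}

/-- The symmetry between the two sides, exchanging the cut edges; each one-sided lemma thereby
serves both pieces. -/
lemma compl (h : G.CrossesAt A B X a₁ b₁ a₂ b₂ f₁ f₂) :
    G.CrossesAt A B (V(G) \ X) a₂ b₂ a₁ b₁ f₂ f₁ where
  subset := Set.sdiff_subset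
  mem_a₁ := ⟨h.mem_a₂.1, h.isLink₂.right_mem, h.mem_a₂.2⟩
  mem_b₁ := ⟨h.mem_b₂.1, h.isLink₁.right_mem, h.mem_b₂.2⟩
  mem_a₂ := ⟨h.mem_a₁.1, fun h' ↦ h'.2 h.mem_a₁.2⟩
  mem_b₂ := ⟨h.mem_b₁.1, fun h' ↦ h'.2 h.mem_b₁.2⟩
  isLink₁ := h.isLink₂.symm
  isLink₂ := h.isLink₁.symm
  of_isLink e x y hl hx hy := by
    have hyX : y ∈ X := by
      by_contra hyX
      exact hy ⟨hl.right_mem, hyX⟩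
    have := h.of_isLink hl.symm hyX hx.2
    tauto

lemma deleteEdges (h : G.CrossesAt A B X a₁ b₁ a₂ b₂ f₁ f₂) {e : β} (he₁ : e ≠ f₁)
    (he₂ : e ≠ f₂) : (G.deleteEdges {e}).CrossesAt A B X a₁ b₁ a₂ b₂ f₁ f₂ where
  subset := h.subset
  mem_a₁ := h.mem_a₁
  mem_b₁ := h.mem_b₁
  mem_a₂ := h.mem_a₂
  mem_b₂ := h.mem_b₂
  isLink₁ := ⟨h.isLink₁, fun h' ↦ he₁ h'.symm⟩
  isLink₂ := ⟨h.isLink₂, fun h' ↦ he₂ h'.symm⟩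
  of_isLink _ _ _ hl := h.of_isLink hl.1

lemma f_ne (h : G.CrossesAt A B X a₁ b₁ a₂ b₂ f₁ f₂) (hAB : G.IsBipartition A B) : f₁ ≠ f₂ := by
  rintro rfl
  rcases h.isLink₁.left_eq_or_eq h.isLink₂ with h' | h'
  · exact hAB.disjoint.le_bot ⟨h.mem_a₁.1, h' ▸ h.mem_b₁.1⟩
  · exact h.mem_a₂.2 (h' ▸ h.mem_a₁.2)

/-- Every edge is in one of the two sides or in the cut. -/
lemma edge_cases (h : G.CrossesAt A B X a₁ b₁ a₂ b₂ f₁ f₂) {e : β} (he : e ∈ E(G)) :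
    e ∈ E(G.induce X) ∨ e ∈ E(G.induce (V(G) \ X)) ∨ e = f₁ ∨ e = f₂ := by
  obtain ⟨x, y, hl⟩ := G.exists_isLink_of_mem_edgeSet he
  by_cases hx : x ∈ X <;> by_cases hy : y ∈ X
  · exact .inl ⟨x, y, hl, hx, hy⟩
  · have := h.of_isLink hl hx hy; tauto
  · have := h.of_isLink hl.symm hy hx; tauto
  · exact .inr (.inl ⟨x, y, hl, ⟨hl.left_mem, hx⟩, hl.right_mem, hy⟩)

lemma edge_ne_of_mem (h : G.CrossesAt A B X a₁ b₁ a₂ b₂ f₁ f₂) {e : β}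
    (he : e ∈ E(G.induce X)) : e ≠ f₁ ∧ e ≠ f₂ := by
  obtain ⟨x, y, hl, hx, hy⟩ := he
  constructor <;> rintro rfl
  · rcases h.isLink₁.right_eq_or_eq hl with h' | h' <;> exact h.mem_b₂.2 (by rw [h']; assumption)
  · rcases h.isLink₂.right_eq_or_eq hl with h' | h' <;> exact h.mem_a₂.2 (by rw [h']; assumption)

end basic

section matchingCovered

variable [DecidableEq α] {A B : Finset α} {X : Set α} {a₁ b₁ a₂ b₂ : α} {f₁ f₂ : β}

lemma isBipartition_induce (hAB : G.IsBipartition (A : Set α) B) (hX : X ⊆ V(G)) :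
    (G.induce X).IsBipartition (part A X) (part B X) := by
  refine ⟨?_, ?_, fun e x y hl ↦ ?_⟩
  · exact hAB.disjoint.mono (Finset.coe_subset.2 part_subset) (Finset.coe_subset.2 part_subset)
  · ext x
    simp only [Set.mem_union, Finset.mem_coe, mem_part, vertexSet_induce]
    refine ⟨by tauto, fun hx ↦ ?_⟩
    have := hAB.mem_vertexSet.1 (hX hx)
    tauto
  · have := hAB.of_isLink hl.1
    simp only [Finset.mem_coe, mem_part] at this ⊢
    have := hl.2
    tauto

lemma neighborsIn_eq (hAB : G.IsBipartition (A : Set α) B)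
    (h : G.CrossesAt A B X a₁ b₁ a₂ b₂ f₁ f₂) {x : α} (hx : x ∈ part A X) :
    G.neighborsIn B x = (G.induce X).neighborsIn (part B X) x ∪
      if x = a₁ then {b₂} else ∅ := by
  obtain ⟨hxA, hxX⟩ := mem_part.1 hx
  ext y
  rw [Finset.mem_union]
  simp only [Graph.mem_neighborsIn, mem_part]
  constructor
  · rintro ⟨hyB, e, hl⟩
    by_cases hy : y ∈ X
    · exact .inl ⟨⟨hyB, hy⟩, e, hl, hxX, hy⟩
    · rcases h.of_isLink hl hxX hy with ⟨-, rfl, rfl⟩ | ⟨-, rfl, -⟩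
      · rw [if_pos rfl]; simp
      · exact (hAB.disjoint.le_bot ⟨hxA, h.mem_b₁.1⟩).elim
  · rintro (⟨⟨hyB, hy⟩, e, hl, -⟩ | h')
    · exact ⟨hyB, e, hl⟩
    · split_ifs at h' with hxa
      · obtain rfl := Finset.mem_singleton.1 h'
        subst hxa
        exact ⟨h.mem_b₂.1, f₁, h.isLink₁⟩
      · simp at h'

lemma part_union_part_compl {C : Finset α} (hC : (C : Set α) ⊆ V(G)) :
    part C X ∪ part C (V(G) \ X) = C := by
  ext x
  simp only [Finset.mem_union, mem_part, Set.mem_sdiff]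
  refine ⟨by tauto, fun hx ↦ ?_⟩
  have : x ∈ V(G) := hC hx
  tauto

lemma disjoint_part_compl (C : Finset α) :
    Disjoint (part C X) (part C (V(G) \ X)) := by
  rw [Finset.disjoint_left]
  intro x hx hx'
  exact (mem_part.1 hx').2.2 (mem_part.1 hx).2

theorem isMatchingCovered_iff (hAB : G.IsBipartition (A : Set α) B)
    (h : G.CrossesAt A B X a₁ b₁ a₂ b₂ f₁ f₂) :
    G.IsMatchingCovered ↔ ((G.induce X).addEar a₁ b₁).IsMatchingCovered ∧
      ((G.induce (V(G) \ X)).addEar a₂ b₂).IsMatchingCovered := by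
  classical
  have ha₁ : a₁ ∈ part A X := mem_part.2 h.mem_a₁
  have hb₁ : b₁ ∈ part B X := mem_part.2 h.mem_b₁
  have ha₂ : a₂ ∈ part A (V(G) \ X) := mem_part.2 h.compl.mem_a₁
  have hb₂ : b₂ ∈ part B (V(G) \ X) := mem_part.2 h.compl.mem_b₁
  rw [isMatchingCovered_iff_expanding hAB,
    isMatchingCovered_addEar_iff (isBipartition_induce hAB h.subset) ha₁ hb₁,
    isMatchingCovered_addEar_iff (isBipartition_induce hAB h.compl.subset) ha₂ hb₂]
  exact expanding_iff_earExpanding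
    (part_union_part_compl (hAB.union_eq ▸ Set.subset_union_left))
    (part_union_part_compl (hAB.union_eq ▸ Set.subset_union_right))
    (disjoint_part_compl A) (disjoint_part_compl B) ha₁ ha₂ hb₁ hb₂
    (fun x _ y hy ↦ (Graph.mem_neighborsIn.1 hy).1) (fun x _ y hy ↦ (Graph.mem_neighborsIn.1 hy).1)
    (fun x hx ↦ neighborsIn_eq hAB h hx) (fun x hx ↦ neighborsIn_eq hAB h.compl hx)

/-- Deleting an edge of the cut from a matching covered graph leaves a graph that is not matching
covered. -/
lemma not_isMatchingCovered_deleteEdges (hAB : G.IsBipartition (A : Set α) B)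
    (h : G.CrossesAt A B X a₁ b₁ a₂ b₂ f₁ f₂) (hG : G.IsMatchingCovered) :
    ¬ (G.deleteEdges {f₁}).IsMatchingCovered := by
  classical
  intro hd
  have ha₁ : a₁ ∈ part A X := mem_part.2 h.mem_a₁
  have hb₁ : b₁ ∈ part B X := mem_part.2 h.mem_b₁
  -- The classes have equally many vertices in `X`. Without `f₁`, all neighbours of `A ∩ X` lie in
  -- `B ∩ X`, so that set has no surplus.
  have hc := ((isMatchingCovered_addEar_iff (isBipartition_induce hAB h.subset) ha₁ hb₁).1
    ((isMatchingCovered_iff hAB h).1 hG).1).card_eq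
  have h1 := (hd.expanding (hAB.deleteEdges _)).lt_card (part A X)
    part_subset ⟨a₁, ha₁⟩ (fun h' ↦ by
      have : a₂ ∈ part A X := h'.symm ▸ h.mem_a₂.1
      exact h.mem_a₂.2 (mem_part.1 this).2)
  have h2 : (part A X).biUnion ((G.deleteEdges {f₁}).neighborsIn B) ⊆
      part B X := by
    intro y hy
    obtain ⟨x, hx, hyx⟩ := Finset.mem_biUnion.1 hy
    obtain ⟨hxA, hxX⟩ := mem_part.1 hx
    obtain ⟨hyB, e, hl, he⟩ := Graph.mem_neighborsIn.1 hyx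
    refine mem_part.2 ⟨hyB, ?_⟩
    by_contra hyX
    rcases h.of_isLink hl hxX hyX with ⟨rfl, -, -⟩ | ⟨-, rfl, -⟩
    · exact he rfl
    · exact hAB.disjoint.le_bot ⟨hxA, h.mem_b₁.1⟩
  have h3 := Finset.card_le_card h2
  omega

theorem isMinimalMatchingCovered_iff (hAB : G.IsBipartition (A : Set α) B)
    (h : G.CrossesAt A B X a₁ b₁ a₂ b₂ f₁ f₂) :
    G.IsMinimalMatchingCovered ↔ ((G.induce X).addEar a₁ b₁).IsMinimalMatchingCovered ∧
      ((G.induce (V(G) \ X)).addEar a₂ b₂).IsMinimalMatchingCovered := by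
  classical
  -- Deleting an edge inside `X` leaves the cut and the other piece untouched, so the matching
  -- covered equivalence applies to `G.deleteEdges {e}`.
  have hdel₁ : ∀ e ∈ E(G.induce X), (G.deleteEdges {e}).IsMatchingCovered ↔
      (((G.induce X).addEar a₁ b₁).deleteEdges {.inl e}).IsMatchingCovered ∧
      ((G.induce (V(G) \ X)).addEar a₂ b₂).IsMatchingCovered := by
    intro e he
    obtain ⟨h1, h2⟩ := h.edge_ne_of_mem he
    rw [deleteEdges_addEar, deleteEdges_induce, ← deleteEdges_induce_compl he]
    exact isMatchingCovered_iff (hAB.deleteEdges _) (h.deleteEdges h1 h2)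
  have hdel₂ : ∀ e ∈ E(G.induce (V(G) \ X)), (G.deleteEdges {e}).IsMatchingCovered ↔
      ((G.induce X).addEar a₁ b₁).IsMatchingCovered ∧
      (((G.induce (V(G) \ X)).addEar a₂ b₂).deleteEdges {.inl e}).IsMatchingCovered := by
    intro e he
    obtain ⟨h1, h2⟩ := h.compl.edge_ne_of_mem he
    rw [deleteEdges_addEar, deleteEdges_induce, ← deleteEdges_induce_of_mem_compl h.subset he]
    exact isMatchingCovered_iff (hAB.deleteEdges _) (h.deleteEdges h2 h1)
  constructor
  · intro hG
    obtain ⟨hm₁, hm₂⟩ := (isMatchingCovered_iff hAB h).1 hG.matchingCovered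
    refine ⟨⟨hm₁, ?_⟩, ⟨hm₂, ?_⟩⟩
    · rintro (e | i) he
      · have he : e ∈ E(G.induce X) := by simpa [edgeSet_addEar] using he
        exact fun hd ↦ hG.minimal e ((induce_le h.subset).edgeSet_mono he)
          ((hdel₁ e he).2 ⟨hd, hm₂⟩)
      · exact not_isMatchingCovered_addEar_deleteEdges (isBipartition_induce hAB h.subset)
          (mem_part.2 h.mem_a₁) (mem_part.2 h.mem_b₁) i
    · rintro (e | i) he
      · have he : e ∈ E(G.induce (V(G) \ X)) := by simpa [edgeSet_addEar] using he
        exact fun hd ↦ hG.minimal e ((induce_le h.compl.subset).edgeSet_mono he)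
          ((hdel₂ e he).2 ⟨hm₁, hd⟩)
      · exact not_isMatchingCovered_addEar_deleteEdges (isBipartition_induce hAB h.compl.subset)
          (mem_part.2 h.compl.mem_a₁) (mem_part.2 h.compl.mem_b₁) i
  · rintro ⟨h₁, h₂⟩
    have hG := (isMatchingCovered_iff hAB h).2 ⟨h₁.matchingCovered, h₂.matchingCovered⟩
    refine ⟨hG, fun e he ↦ ?_⟩
    rcases h.edge_cases he with he | he | rfl | rfl
    · exact fun hd ↦ h₁.minimal (.inl e) (by simpa [edgeSet_addEar] using he)
        ((hdel₁ e he).1 hd).1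
    · exact fun hd ↦ h₂.minimal (.inl e) (by simpa [edgeSet_addEar] using he)
        ((hdel₂ e he).1 hd).2
    · exact not_isMatchingCovered_deleteEdges hAB h hG
    · exact not_isMatchingCovered_deleteEdges hAB h.compl hG

end matchingCovered

end CrossesAt

end Graph

/-! ### Counting vertices, edges and vertices of degree two -/

namespace Graph

variable {α β : Type*} {G : Graph α β}

lemma ncard_image_inl_union_image_inr {γ δ : Type*} {s : Set γ} (hs : s.Finite) {t : Set δ}
    (ht : t.Finite) :
    ((Sum.inl '' s ∪ Sum.inr '' t : Set (γ ⊕ δ))).ncard = s.ncard + t.ncard := by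
  rw [Set.ncard_union_eq _ (hs.image _) (ht.image _),
    Set.ncard_image_of_injective _ Sum.inl_injective,
    Set.ncard_image_of_injective _ Sum.inr_injective]
  rw [Set.disjoint_left]
  rintro _ ⟨x, -, rfl⟩ ⟨y, -, h⟩
  simp at h

lemma ncard_image_inl_union_range_inr {γ : Type*} {s : Set γ} (hs : s.Finite) (k : ℕ) :
    ((Sum.inl '' s ∪ Set.range Sum.inr : Set (γ ⊕ Fin k))).ncard = s.ncard + k := by
  rw [← Set.image_univ, ncard_image_inl_union_image_inr hs Set.finite_univ, Set.ncard_univ,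
    Nat.card_eq_fintype_card, Fintype.card_fin]

section addEar

variable {H : Graph α β} {a b : α}

lemma incidenceSet_addEar_inl (x : α) : (H.addEar a b).incidenceSet (.inl x) =
    Sum.inl '' H.incidenceSet x ∪ Sum.inr '' {i | (i = 0 ∧ x = a) ∨ (i = 2 ∧ x = b)} := by
  ext (e | i)
  · simp only [incidenceSet, Inc, Set.mem_ofPred_eq, addEar_isLink_inl]
    simp
  · simp only [incidenceSet, Inc, Set.mem_ofPred_eq, addEar_isLink_inr]
    fin_cases i <;> simp [earEnds]

lemma incidenceSet_addEar_zero :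
    (H.addEar a b).incidenceSet (.inr 0) = {.inr 0, .inr 1} := by
  ext (e | i)
  · simp only [incidenceSet, Inc, Set.mem_ofPred_eq, addEar_isLink_inl]
    simp
  · simp only [incidenceSet, Inc, Set.mem_ofPred_eq, addEar_isLink_inr]
    fin_cases i <;> simp [earEnds]

lemma incidenceSet_addEar_one :
    (H.addEar a b).incidenceSet (.inr 1) = {.inr 1, .inr 2} := by
  ext (e | i)
  · simp only [incidenceSet, Inc, Set.mem_ofPred_eq, addEar_isLink_inl]
    simp
  · simp only [incidenceSet, Inc, Set.mem_ofPred_eq, addEar_isLink_inr]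
    fin_cases i <;> simp [earEnds]

lemma inr_mem_degreeTwoSet_addEar (i : Fin 2) : .inr i ∈ (H.addEar a b).degreeTwoSet := by
  refine ⟨.inr ⟨i, rfl⟩, ?_⟩
  fin_cases i
  · exact (congrArg Set.ncard incidenceSet_addEar_zero).trans (Set.ncard_pair (by simp))
  · exact (congrArg Set.ncard incidenceSet_addEar_one).trans (Set.ncard_pair (by simp))

end addEar

namespace CrossesAt

variable {A B X : Set α} {a₁ b₁ a₂ b₂ : α} {f₁ f₂ : β}

lemma incidenceSet_eq (h : G.CrossesAt A B X a₁ b₁ a₂ b₂ f₁ f₂) {x : α} (hx : x ∈ X) :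
    G.incidenceSet x =
      (G.induce X).incidenceSet x ∪ {f | (f = f₁ ∧ x = a₁) ∨ (f = f₂ ∧ x = b₁)} := by
  ext e
  constructor
  · rintro ⟨y, hl⟩
    by_cases hy : y ∈ X
    · exact .inl ⟨y, hl, hx, hy⟩
    · right
      have := h.of_isLink hl hx hy
      change (e = f₁ ∧ x = a₁) ∨ (e = f₂ ∧ x = b₁)
      tauto
  · rintro (⟨y, hl⟩ | ⟨rfl, rfl⟩ | ⟨rfl, rfl⟩)
    · exact ⟨y, hl.1⟩
    · exact h.isLink₁.inc_left
    · exact h.isLink₂.inc_left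

/-- The vertex `a₁` trades `f₁` for the first ear edge and `b₁` trades `f₂` for the last; as `a₁ ≠
b₁`, each makes one trade. -/
lemma ncard_incidenceSet_addEar (h : G.CrossesAt A B X a₁ b₁ a₂ b₂ f₁ f₂)
    (hAB : G.IsBipartition A B) (hE : E(G).Finite) {x : α} (hx : x ∈ X) :
    (((G.induce X).addEar a₁ b₁).incidenceSet (.inl x)).ncard = (G.incidenceSet x).ncard := by
  have hab : a₁ ≠ b₁ := fun h' ↦ hAB.disjoint.le_bot ⟨h.mem_a₁.1, h' ▸ h.mem_b₁.1⟩
  have hfin : ((G.induce X).incidenceSet x).Finite :=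
    hE.subset fun e he ↦ (induce_le h.subset).edgeSet_mono (Inc.edge_mem he)
  have hfin' : {f | (f = f₁ ∧ x = a₁) ∨ (f = f₂ ∧ x = b₁)}.Finite :=
    (Set.toFinite {f₁, f₂}).subset (by rintro f (⟨rfl, -⟩ | ⟨rfl, -⟩) <;> simp)
  have hd : Disjoint ((G.induce X).incidenceSet x)
      {f | (f = f₁ ∧ x = a₁) ∨ (f = f₂ ∧ x = b₁)} := by
    rw [Set.disjoint_left]
    intro e he he'
    obtain ⟨h1, h2⟩ := h.edge_ne_of_mem (Inc.edge_mem he)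
    rcases he' with h' | h'
    · exact h1 h'.1
    · exact h2 h'.1
  rw [incidenceSet_addEar_inl, ncard_image_inl_union_image_inr hfin (Set.toFinite _),
    h.incidenceSet_eq hx, Set.ncard_union_eq hd hfin hfin']
  congr 1
  by_cases hxa : x = a₁
  · subst hxa; simp [hab]
  · by_cases hxb : x = b₁
    · subst hxb; simp [hxa]
    · simp [hxa, hxb]

lemma ncard_degreeTwoSet_addEar (h : G.CrossesAt A B X a₁ b₁ a₂ b₂ f₁ f₂)
    (hAB : G.IsBipartition A B) (hV : V(G).Finite) (hE : E(G).Finite) :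
    ((G.induce X).addEar a₁ b₁).degreeTwoSet.ncard = (G.degreeTwoSet ∩ X).ncard + 2 := by
  rw [← ncard_image_inl_union_range_inr
    (hV.subset (Set.inter_subset_right.trans h.subset)) 2]
  congr 1
  ext (x | i)
  · simp only [degreeTwoSet, Set.mem_ofPred_eq,
      vertexSet_addEar (H := G.induce X) h.mem_a₁.2 h.mem_b₁.2]
    simp only [vertexSet_induce, Set.mem_union, Set.mem_image, Sum.inl.injEq, exists_eq_right,
      Set.mem_range, reduceCtorEq, exists_false, or_false, Set.mem_inter_iff]
    constructor
    · rintro ⟨hx, h2⟩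
      rw [h.ncard_incidenceSet_addEar hAB hE hx] at h2
      exact ⟨⟨h.subset hx, h2⟩, hx⟩
    · rintro ⟨⟨-, h2⟩, hx⟩
      exact ⟨hx, (h.ncard_incidenceSet_addEar hAB hE hx).trans h2⟩
  · simpa using inr_mem_degreeTwoSet_addEar i

lemma ncard_vertexSet_addEar (h : G.CrossesAt A B X a₁ b₁ a₂ b₂ f₁ f₂) (hV : V(G).Finite) :
    V((G.induce X).addEar a₁ b₁).ncard = X.ncard + 2 := by
  rw [vertexSet_addEar (H := G.induce X) h.mem_a₁.2 h.mem_b₁.2]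
  exact ncard_image_inl_union_range_inr (hV.subset h.subset) 2

lemma ncard_edgeSet_addEar (h : G.CrossesAt A B X a₁ b₁ a₂ b₂ f₁ f₂) (hE : E(G).Finite) :
    E((G.induce X).addEar a₁ b₁).ncard = E(G.induce X).ncard + 3 := by
  rw [edgeSet_addEar]
  exact ncard_image_inl_union_range_inr (hE.subset (induce_le h.subset).edgeSet_mono) 3

lemma ncard_edgeSet (h : G.CrossesAt A B X a₁ b₁ a₂ b₂ f₁ f₂) (hAB : G.IsBipartition A B)
    (hE : E(G).Finite) :
    E(G).ncard = E(G.induce X).ncard + E(G.induce (V(G) \ X)).ncard + 2 := by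
  have h₁ : E(G.induce X) ⊆ E(G) := (induce_le h.subset).edgeSet_mono
  have h₂ : E(G.induce (V(G) \ X)) ⊆ E(G) := (induce_le h.compl.subset).edgeSet_mono
  have hEq : E(G) = (E(G.induce X) ∪ E(G.induce (V(G) \ X))) ∪ {f₁, f₂} := by
    ext e
    constructor
    · intro he
      have := h.edge_cases he
      simp only [Set.mem_union, Set.mem_insert_iff, Set.mem_singleton_iff]
      tauto
    · rintro ((he | he) | rfl | rfl)
      · exact h₁ he
      · exact h₂ he
      · exact h.isLink₁.edge_mem
      · exact h.isLink₂.edge_mem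
  rw [hEq, Set.ncard_union_eq _ ((hE.subset h₁).union (hE.subset h₂)) (Set.toFinite _),
    Set.ncard_union_eq _ (hE.subset h₁) (hE.subset h₂), Set.ncard_pair (h.f_ne hAB)]
  · rw [Set.disjoint_left]
    rintro e ⟨x, y, hl, hx, -⟩ ⟨x', y', hl', hx', hy'⟩
    rcases hl.left_eq_or_eq hl' with rfl | rfl
    · exact hx'.2 hx
    · exact hy'.2 hx
  · rw [Set.disjoint_left]
    rintro e (he | he) (rfl | rfl)
    · exact (h.edge_ne_of_mem he).1 rfl
    · exact (h.edge_ne_of_mem he).2 rfl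
    · exact (h.compl.edge_ne_of_mem he).2 rfl
    · exact (h.compl.edge_ne_of_mem he).1 rfl

lemma ncard_degreeTwoSet (h : G.CrossesAt A B X a₁ b₁ a₂ b₂ f₁ f₂) (hV : V(G).Finite) :
    G.degreeTwoSet.ncard =
      (G.degreeTwoSet ∩ X).ncard + (G.degreeTwoSet ∩ (V(G) \ X)).ncard := by
  rw [← Set.ncard_union_eq _ (hV.subset (Set.inter_subset_right.trans h.subset))
    (hV.subset (Set.inter_subset_right.trans Set.sdiff_subset)), ← Set.inter_union_distrib_left,
    Set.union_sdiff_cancel h.subset, Set.inter_eq_left.2 fun x hx ↦ hx.1]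
  exact (Set.disjoint_sdiff_right).mono Set.inter_subset_right Set.inter_subset_right

end CrossesAt

end Graph

theorem theorem5p1 {α β : Type*} (G : Graph α β)
    (hV : (Graph.vertexSet G).Finite) (hE : (Graph.edgeSet G).Finite)
    (A B : Set α) (hAB : G.IsBipartition A B) (X : Set α)
    (G₁ G₂ : Graph (α ⊕ Fin 2) (β ⊕ Fin 3)) (hdec : G.IsTwoCutDecomposition A B X G₁ G₂) :
    (G₁.IsBipartite ∧ G₂.IsBipartite) ∧
    (G.IsMatchingCovered ↔ G₁.IsMatchingCovered ∧ G₂.IsMatchingCovered) ∧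
    (G.IsMinimalMatchingCovered ↔
      G₁.IsMinimalMatchingCovered ∧ G₂.IsMinimalMatchingCovered) ∧
    (G.IsExtremal ↔ G₁.IsExtremal ∧ G₂.IsExtremal) := by
  classical
  obtain ⟨a₁, b₁, a₂, b₂, f₁, f₂, h, rfl, rfl⟩ := hdec.exists_crossesAt hAB hE
  lift A to Finset α using hV.subset (hAB.union_eq ▸ Set.subset_union_left)
  lift B to Finset α using hV.subset (hAB.union_eq ▸ Set.subset_union_right)
  have hbip₁ : ((G.induce X).addEar a₁ b₁).IsBipartite :=
    ⟨_, _, (Graph.CrossesAt.isBipartition_induce hAB h.subset).addEar (Graph.mem_part.2 h.mem_a₁)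
      (Graph.mem_part.2 h.mem_b₁)⟩
  have hbip₂ : ((G.induce (V(G) \ X)).addEar a₂ b₂).IsBipartite :=
    ⟨_, _, (Graph.CrossesAt.isBipartition_induce hAB h.compl.subset).addEar (Graph.mem_part.2 h.compl.mem_a₁)
      (Graph.mem_part.2 h.compl.mem_b₁)⟩
  have hmin := h.isMinimalMatchingCovered_iff hAB
  refine ⟨⟨hbip₁, hbip₂⟩, h.isMatchingCovered_iff hAB, hmin, ?_⟩
  have v := Set.ncard_sdiff_add_ncard_of_subset h.subset hV
  have v₁ := h.ncard_vertexSet_addEar hV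
  have v₂ := h.compl.ncard_vertexSet_addEar hV
  have e := h.ncard_edgeSet hAB hE
  have e₁ := h.ncard_edgeSet_addEar hE
  have e₂ := h.compl.ncard_edgeSet_addEar hE
  have d := h.ncard_degreeTwoSet hV
  have d₁ := h.ncard_degreeTwoSet_addEar hAB hV hE
  have d₂ := h.compl.ncard_degreeTwoSet_addEar hAB hV hE
  -- The counts above make `|V₂| - 2(m - n + 2)` for `G` the sum of the same quantities for the two
  -- pieces. Both summands are nonnegative for minimal pieces, so a zero sum forces both to vanish.
  constructor
  · rintro ⟨-, hm, hc⟩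
    obtain ⟨hm₁, hm₂⟩ := hmin.1 hm
    have l₁ := hm₁.le_ncard_degreeTwoSet hbip₁ (Set.finite_of_ncard_pos (by omega))
      (Set.finite_of_ncard_pos (by omega))
    have l₂ := hm₂.le_ncard_degreeTwoSet hbip₂ (Set.finite_of_ncard_pos (by omega))
      (Set.finite_of_ncard_pos (by omega))
    exact ⟨⟨hbip₁, hm₁, by omega⟩, ⟨hbip₂, hm₂, by omega⟩⟩
  · rintro ⟨⟨-, hm₁, hc₁⟩, ⟨-, hm₂, hc₂⟩⟩
    exact ⟨⟨A, B, hAB⟩, hmin.2 ⟨hm₁, hm₂⟩, by omega⟩
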